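/- All graphs are finite and simple and have at least one vertex. For a graph $G$ and $D \subseteq V(G)$, let $N[D]$ be the set of vertices that lie in $D$ or are adjacent to a vertex of $D$. The domination number $\gamma(G)$ is the smallest size of a set $D \subseteq V(G)$ with $N[D] = V(G)$. For a graph $F$, the $F$-isolation number $\iota(G,F)$ is the smallest size of a set $D \subseteq V(G)$ such that $N[D]$ intersects the vertex set of every (not necessarily induced) subgraph of $G$ that is isomorphic to $F$. For a set $\mathcal{G}$ of graphs, the dominating set problem for $\mathcal{G}$ is the problem of deciding, given a graph $G$ in $\mathcal{G}$ (up to isomorphism, presented by an adjacency matrix) and an integer $t$ (in binary), whether $\gamma(G) \leq t$; the $F$-isolating set problem for $\mathcal{G}$ is the problem of deciding, given a graph $G$ in $\mathcal{G}$ and an integer $t$, presented in the same way, whether $\iota(G,F) \leq t$. Such a problem is in NP if it has a polynomial-time verifier with certificates of polynomial length that is correct on all its instances, and it is NP-complete if it is in NP and, in addition, for every language $L$ in NP there is a polynomial-time map that sends each string to an instance of the problem and sends precisely the strings of $L$ to yes-instances. Fix a vertex $u$ of $F$. For a graph $G$ with vertices $v_1, \dots, v_n$, let $F_1, \dots, F_n$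 be pairwise vertex-disjoint copies of $F$ such that, for each $i$, $V(F_i) \cap V(G) = \{v_i\}$ and $v_i$ is the vertex of $F_i$ corresponding to $u$. Let $C(G,F)$ be the graph with vertex set $\bigcup_{i=1}^n V(F_i)$ and edge set $E(G) \cup \bigcup_{i=1}^n E(F_i)$. **Theorem.** Let $F$ be a connected graph, let $u \in V(F)$, and let $\mathcal{G}$ be a set of graphs. If the dominating set problem is NP-complete for $\mathcal{G}$, then the $F$-isolating set problem is NP-complete for $\{C(G,F) : G \in \mathcal{G}\}$. -/

import Mathlib

open Computability Turing

noncomputable section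

/-! ### Finite simple graphs, domination, isolation -/

/-- A graph: finite, simple, and with at least one vertex. -/
structure FiniteGraph where
  V : Type
  graph : SimpleGraph V
  finite_V : Finite V
  nonempty_V : Nonempty V

namespace SimpleGraph

variable {V W : Type*}

/-- The closed neighbourhood `N[D]` of a set `D` of vertices of `G`. -/
def closedNbhd (G : SimpleGraph V) (D : Finset V) : Set V :=
  {v | v ∈ D ∨ ∃ d ∈ D, G.Adj d v}

/-- `D` is a dominating set of `G`: `N[D] = V(G)`. -/
def IsDominatingSet (G : SimpleGraph V) (D : Finset V) : Prop :=
  G.closedNbhd D = Set.univ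

/-- The domination number `γ(G)` (of a finite graph `G`). -/
def dominationNum (G : SimpleGraph V) : ℕ :=
  sInf {k | ∃ D : Finset V, G.IsDominatingSet D ∧ D.card = k}

/-- `D` is an `F`-isolating set of `G`: the vertex set of every copy of `F` in `G` (as a not
necessarily induced subgraph) intersects `N[D]`. -/
def IsIsolatingSet (G : SimpleGraph V) (F : SimpleGraph W) (D : Finset V) : Prop :=
  ∀ f : F.Copy G, ∃ x : W, f x ∈ G.closedNbhd D

/-- The `F`-isolation number `ι(G, F)` (of a finite graph `G`, for non-null `F`). -/
def isolationNum (G : SimpleGraph V) (F : SimpleGraph W) : ℕ :=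
  sInf {k | ∃ D : Finset V, G.IsIsolatingSet F D ∧ D.card = k}

/-- The graph `C(G, F)` with respect to the vertex `u` of `F`: to every vertex `v` of `G` a copy
of `F`, with vertex set `{v} × V(F)`, is attached by identifying `v` with the copy `(v, u)`
of `u`. -/
def attachCopies (G : SimpleGraph V) (F : SimpleGraph W) (u : W) : SimpleGraph (V × W) where
  Adj p q := (p.1 = q.1 ∧ F.Adj p.2 q.2) ∨ (p.2 = u ∧ q.2 = u ∧ G.Adj p.1 q.1)
  symm := ⟨by
    rintro p q (⟨h, h'⟩ | ⟨h, h', h''⟩)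
    · exact Or.inl ⟨h.symm, h'.symm⟩
    · exact Or.inr ⟨h', h, h''.symm⟩⟩
  loopless := ⟨by
    rintro p (⟨_, h⟩ | ⟨_, _, h⟩)
    · exact F.irrefl h
    · exact G.irrefl h⟩

end SimpleGraph

/-- `C(G, F)` as a finite graph. -/
def FiniteGraph.attachCopies (F : FiniteGraph) (u : F.V) (G : FiniteGraph) : FiniteGraph where
  V := G.V × F.V
  graph := G.graph.attachCopies F.graph u
  finite_V := by
    have := G.finite_V
    have := F.finite_V
    infer_instance
  nonempty_V := by
    have := G.nonempty_V
    have := F.nonempty_V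
    infer_instance

/-! ### Decision problems, polynomial-time reductions, NP -/

/-- An injective encoding, with a decoding obtained by choice. -/
def encodingOfInjective {α Γ : Type} (f : α → List Γ) (hf : Function.Injective f) :
    Encoding α Γ where
  encode := f
  decode := Function.partialInv f
  decode_encode := Function.partialInv_left hf

/-- A decision problem: a set of instances, each encoded as a string over a finite alphabet, and
the set of yes-instances. -/
structure DecisionProblem where
  Instance : Type
  Alphabet : Type
  fintypeAlphabet : Fintype Alphabet
  encoding : Encoding Instance Alphabet
  Yes : Instance → Prop

namespace DecisionProblem

/-- The problem of deciding membership in a language over `{0, 1}`; all strings are instances. -/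
def ofLanguage (L : Language Bool) : DecisionProblem where
  Instance := List Bool
  Alphabet := Bool
  fintypeAlphabet := inferInstance
  encoding := encodingList Bool
  Yes x := x ∈ L

/-- The class NP: there is a verifier, running in polynomial time on a Turing machine, such that
the yes-instances are those that have a certificate of polynomially bounded length which the
verifier accepts. -/
def InNP (P : DecisionProblem) : Prop :=
  ∃ (verifier : P.Instance × List Bool → Bool) (bound : Polynomial ℕ),
    Nonempty (TM2ComputableInPolyTime (encodingProd P.encoding (encodingList Bool)).encode
      encodeBool verifier) ∧
    ∀ a : P.Instance, P.Yes a ↔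
      ∃ w : List Bool, w.length ≤ bound.eval (P.encoding.encode a).length ∧
        verifier (a, w) = true

/-- Polynomial-time many-one (Karp) reducibility. The reduction maps instances of `P` to
instances of `Q`. -/
def ReducesTo (P Q : DecisionProblem) : Prop :=
  ∃ f : P.Instance → Q.Instance,
    Nonempty (TM2ComputableInPolyTime P.encoding.encode Q.encoding.encode f) ∧
    ∀ a : P.Instance, P.Yes a ↔ Q.Yes (f a)

/-- NP-hardness: every language in NP reduces to `P`. -/
def NPHard (P : DecisionProblem) : Prop :=
  ∀ L : Language Bool, (ofLanguage L).InNP → (ofLanguage L).ReducesTo P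

/-- NP-completeness. -/
def NPComplete (P : DecisionProblem) : Prop :=
  P.InNP ∧ P.NPHard

end DecisionProblem

/-! ### Instances `(G, t)` and their encoding -/

open Classical in
/-- The adjacency matrix of a graph with vertices `0, …, n - 1`, row by row, where every row is
followed by the separator `none`. -/
def encodeGraph (G : Σ n : ℕ, SimpleGraph (Fin n)) : List (Option Bool) :=
  (List.ofFn fun i : Fin G.1 =>
    (List.ofFn fun j : Fin G.1 => some (decide (G.2.Adj i j))) ++ [none]).flatten

theorem encodeGraph_count (G : Σ n : ℕ, SimpleGraph (Fin n)) :
    (encodeGraph G).count none = G.1 := by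
  have h : ∀ i : Fin G.1, List.count none (List.ofFn fun j : Fin G.1 =>
      (some (@decide (G.2.Adj i j) (Classical.propDecidable _)))) = 0 := by
    intro i
    rw [List.count_eq_zero]
    simp [List.mem_ofFn]
  simp [encodeGraph, List.count_flatten, List.map_ofFn, Function.comp_def, h]

theorem encodeGraph_injective : Function.Injective encodeGraph := by
  rintro ⟨n, G⟩ ⟨m, H⟩ h
  obtain rfl : n = m := by
    have hn := encodeGraph_count ⟨n, G⟩
    rw [h, encodeGraph_count] at hn
    exact hn.symm
  congr 1
  unfold encodeGraph at h
  have h2 := List.eq_iff_flatten_eq.mpr ⟨h, by simp [List.map_ofFn, Function.comp_def]⟩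
  have h3 := List.ofFn_injective h2
  ext i j
  have h4 := List.ofFn_injective (List.append_cancel_right (congrFun h3 i))
  simpa using congrFun h4 j

/-- Sign bit followed by the binary digits of the absolute value. -/
def encodeInt (t : ℤ) : List Bool :=
  decide (t < 0) :: encodeNat t.natAbs

theorem encodeInt_injective : Function.Injective encodeInt := by
  intro s t h
  simp only [encodeInt, List.cons.injEq, decide_eq_decide] at h
  have h2 : s.natAbs = t.natAbs := by
    rw [← decode_encodeNat s.natAbs, h.2, decode_encodeNat]
  omega

/-- The labelled graphs, with vertices `0, …, n - 1` for some `n`, that represent a member of the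
class `𝒢`, that is, are isomorphic to one. -/
def GraphIn (𝒢 : Set FiniteGraph) : Type :=
  {G : Σ n : ℕ, SimpleGraph (Fin n) // ∃ H ∈ 𝒢, Nonempty (G.2 ≃g H.graph)}

def encodingGraphIn (𝒢 : Set FiniteGraph) : Encoding (GraphIn 𝒢) (Option Bool) :=
  encodingOfInjective (fun G => encodeGraph G.1)
    (encodeGraph_injective.comp Subtype.val_injective)

def encodingInt : Encoding ℤ Bool :=
  encodingOfInjective encodeInt encodeInt_injective

/-- The dominating set problem for the class `𝒢`: given a graph `G` in `𝒢` and an integer `t`,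
is `γ(G) ≤ t`? -/
def dominatingSetProblem (𝒢 : Set FiniteGraph) : DecisionProblem where
  Instance := GraphIn 𝒢 × ℤ
  Alphabet := Option Bool ⊕ Bool
  fintypeAlphabet := inferInstance
  encoding := encodingProd (encodingGraphIn 𝒢) encodingInt
  Yes x := (x.1.1.2.dominationNum : ℤ) ≤ x.2

/-- The `F`-isolating set problem for the class `𝒢`: given a graph `G` in `𝒢` and an integer `t`,
is `ι(G, F) ≤ t`? -/
def isolatingSetProblem (F : FiniteGraph) (𝒢 : Set FiniteGraph) : DecisionProblem where
  Instance := GraphIn 𝒢 × ℤ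
  Alphabet := Option Bool ⊕ Bool
  fintypeAlphabet := inferInstance
  encoding := encodingProd (encodingGraphIn 𝒢) encodingInt
  Yes x := (x.1.1.2.isolationNum F.graph : ℤ) ≤ x.2

end

/-! The core is the equality ι(C(G,F), F) = γ(G), `SimpleGraph.isolationNum_eq_dominationNum`. If D
isolates C(G,F), then its projection to V(G) dominates G: N[D] meets the copy of F attached at each
v, and a vertex of that copy is dominated only from within the copy or from a G-neighbour of v.
Conversely, let D dominate G, and label every vertex of C(G,F) by the vertex of F to which it
corresponds. The vertices labelled u lie in N[D], and away from them the labelling is a locally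
injective homomorphism to F. A copy of F avoiding N[D], followed by the labelling, would be a
locally injective endomorphism of F that misses u. This is impossible, since such an endomorphism of
a finite connected graph is surjective (`SimpleGraph.Connected.surjective_of_locally_injective`).

Hence (G, t) ↦ (C(G,F), t) preserves yes- and no-instances. As F is fixed, a stack machine expands
the adjacency matrix in polynomial time (`dominatingSetProblem_reducesTo`). Hardness follows because
reductions compose, which for machines is `Turing.TM2ComputableInPolyTime.nonempty_comp`.

For membership in NP, the certificate is D together with the labelling
(`SimpleGraph.IsIsolationLabelling`). Its validity is a condition on the neighbourhood of each
vertex, so a finite automaton checks it on each row of the adjacency matrix, and no search for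
copies of F is needed. A valid labelling proves isolation in any graph; that one exists whenever ι ≤
t depends on the graph being some C(G,F).

Both machines are written as a `StackMachine`, which is compiled to a `FinTM2` that clears its
stacks before halting. -/

noncomputable section

namespace Turing

/-! ### Runs of bounded length -/

/-- `RunsIn f n a b`: iterating the partial function `f` leads from `a` to `b` in at most `n`
steps. -/
inductive RunsIn {α : Type*} (f : α → Option α) : ℕ → α → α → Prop
  | refl (n : ℕ) (a : α) : RunsIn f n a a
  | head {n : ℕ} {a b c : α} : f a = some b → RunsIn f n b c → RunsIn f (n + 1) a c

namespace RunsIn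

variable {α β : Type*} {f : α → Option α} {g : β → Option β} {m n : ℕ} {a b c : α}

theorem mono (h : RunsIn f m a b) (hmn : m ≤ n) : RunsIn f n a b := by
  induction h generalizing n with
  | refl m a => exact refl n a
  | head h _ ih =>
    obtain ⟨n, rfl⟩ := Nat.exists_eq_add_of_lt (Nat.lt_of_succ_le hmn)
    exact head h (ih (by omega))

theorem trans (h₁ : RunsIn f m a b) (h₂ : RunsIn f n b c) : RunsIn f (m + n) a c := by
  induction h₁ with
  | refl m a => exact h₂.mono (Nat.le_add_left _ _)
  | head h _ ih => rw [Nat.add_right_comm]; exact head h (ih h₂)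

theorem map (φ : α → β) (hφ : ∀ a a', f a = some a' → g (φ a) = some (φ a'))
    (h : RunsIn f n a b) : RunsIn g n (φ a) (φ b) := by
  induction h with
  | refl m a => exact refl _ _
  | head h _ ih => exact head (hφ _ _ h) ih

theorem of_iterate (h : (flip bind f)^[n] (some a) = some b) : RunsIn f n a b := by
  induction n generalizing a with
  | zero => cases h; exact refl _ _
  | succ n ih =>
    rw [Function.iterate_succ_apply] at h
    change (flip bind f)^[n] (f a) = some b at h
    cases hfa : f a with
    | none =>
      rw [hfa] at h
      have : ∀ n, (flip bind f)^[n] none = none := fun n => Function.iterate_fixed rfl n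
      rw [this] at h
      cases h
    | some a' => exact head hfa (ih (hfa ▸ h))

theorem exists_iterate (h : RunsIn f n a b) :
    ∃ m ≤ n, (flip bind f)^[m] (some a) = some b := by
  induction h with
  | refl n a => exact ⟨0, Nat.zero_le _, rfl⟩
  | @head n a b c h _ ih =>
    obtain ⟨m, hm, hb⟩ := ih
    refine ⟨m + 1, by omega, ?_⟩
    rw [Function.iterate_succ_apply]
    change (flip bind f)^[m] (f a) = _
    rw [h, hb]

theorem of_evalsToInTime (h : StateTransition.EvalsToInTime f a (some b) n) : RunsIn f n a b :=
  (of_iterate h.evals_in_steps).mono h.steps_le_m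

theorem evalsToInTime (h : RunsIn f n a b) :
    Nonempty (StateTransition.EvalsToInTime f a (some b) n) := by
  obtain ⟨m, hm, hb⟩ := h.exists_iterate
  exact ⟨⟨⟨m, hb⟩, hm⟩⟩

/-- A quantity that grows by at most `d` in each step grows by at most `d * n` in `n` steps. -/
theorem le_add_mul {μ : α → ℕ} {d : ℕ} (hμ : ∀ a a', f a = some a' → μ a' ≤ μ a + d)
    (h : RunsIn f n a b) : μ b ≤ μ a + d * n := by
  induction h with
  | refl m a => omega
  | head h _ ih => have := hμ _ _ h; rw [Nat.mul_add]; omega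

end RunsIn

/-! ### Initial and final configurations -/

theorem initList_eq (tm : FinTM2) (s : List (tm.Γ tm.k₀)) :
    initList tm s = ⟨some tm.main, tm.initialState, Function.update (fun _ => []) tm.k₀ s⟩ := by
  unfold initList
  congr 1
  funext k
  by_cases h : k = tm.k₀
  · subst h; simp
  · simp [h]

theorem haltList_eq (tm : FinTM2) (s : List (tm.Γ tm.k₁)) :
    haltList tm s = ⟨none, tm.initialState, Function.update (fun _ => []) tm.k₁ s⟩ := by
  unfold haltList
  congr 1
  funext k
  by_cases h : k = tm.k₁
  · subst h; simp
  · simp [h]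

/-- Polynomial-time computability from runs of bounded length. -/
theorem nonempty_computableInPolyTime {α β αΓ βΓ : Type} {ea : α → List αΓ} {eb : β → List βΓ}
    {f : α → β} (tm : FinTM2) (ei : tm.Γ tm.k₀ ≃ αΓ) (eo : tm.Γ tm.k₁ ≃ βΓ)
    (time : Polynomial ℕ)
    (h : ∀ a, RunsIn tm.step (time.eval (ea a).length) (initList tm ((ea a).map ei.symm))
      (haltList tm ((eb (f a)).map eo.symm))) :
    Nonempty (TM2ComputableInPolyTime ea eb f) :=
  ⟨{ tm := tm, inputAlphabet := ei, outputAlphabet := eo, time := time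
     outputsFun := fun a => (h a).evalsToInTime.some }⟩

theorem TM2ComputableInPolyTime.runsIn {α β αΓ βΓ : Type} {ea : α → List αΓ} {eb : β → List βΓ}
    {f : α → β} (h : TM2ComputableInPolyTime ea eb f) (a : α) :
    RunsIn h.tm.step (h.time.eval (ea a).length)
      (initList h.tm ((ea a).map h.inputAlphabet.symm))
      (haltList h.tm ((eb (f a)).map h.outputAlphabet.symm)) :=
  RunsIn.of_evalsToInTime (h.outputsFun a)

/-! ### Statements: counting pushes, moving a stack, embedding into a larger machine -/

namespace TM2

variable {K K' : Type*}

namespace Stmt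

variable {Λ Λ' σ σ' : Type*}

/-- The maximal number of symbols that a statement pushes. -/
def pushes {Γ : K → Type*} : Stmt Γ Λ σ → ℕ
  | push _ _ q => pushes q + 1
  | peek _ _ q => pushes q
  | pop _ _ q => pushes q
  | load _ q => pushes q
  | branch _ q₁ q₂ => pushes q₁ + pushes q₂
  | goto _ => 0
  | halt => 0

/-- This limits how fast a stack, in particular the output, can grow. A crude bound suffices, so the
pushes of both branches are added. -/
theorem length_stepAux_le [DecidableEq K] {Γ : K → Type*} (q : Stmt Γ Λ σ) (v : σ)
    (S : ∀ k, List (Γ k)) (k : K) :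
    ((stepAux q v S).stk k).length ≤ (S k).length + q.pushes := by
  induction q generalizing v S with
  | push k' f q ih =>
    refine (ih _ _).trans ?_
    rcases eq_or_ne k k' with rfl | h
    · simp [pushes]; omega
    · simp [pushes, h]
  | pop k' f q ih =>
    refine (ih _ _).trans ?_
    rcases eq_or_ne k k' with rfl | h
    · simp [pushes]
    · simp [pushes, h]
  | peek k' f q ih => exact ih _ _
  | load f q ih => exact ih _ _
  | branch f q₁ q₂ ih₁ ih₂ =>
    simp only [stepAux, pushes]
    cases f v
    · exact (ih₂ _ _).trans (by omega)
    · exact (ih₁ _ _).trans (by omega)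
  | goto f => simp [pushes]
  | halt => simp [pushes]

/-- Pushing the symbol held by the state, for a state that holds one. -/
def pushOption {Γ : K → Type*} (k : K) (f : σ → Option (Γ k)) (q : Stmt Γ Λ σ) : Stmt Γ Λ σ :=
  open Classical in
  -- `push` needs a symbol for every state. The default is never used in `move`, where the preceding
  -- branch has found a symbol.
  if h : Nonempty (Γ k) then push k (fun v => (f v).getD h.some) q else q

theorem stepAux_pushOption [DecidableEq K] {Γ : K → Type*} {k : K} {f : σ → Option (Γ k)}
    {q : Stmt Γ Λ σ} {v : σ} {x : Γ k} (hx : f v = some x) (S : ∀ k, List (Γ k)) :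
    stepAux (pushOption k f q) v S = stepAux q v (Function.update S k (x :: S k)) := by
  have h : Nonempty (Γ k) := ⟨x⟩
  simp [pushOption, h, hx]

/-- One round of a loop that moves the content of stack `k` to stack `k'`. -/
def move {Γ : K → Type*} (k k' : K) (e : Γ k → Γ k') (get : σ → Option (Γ k'))
    (put : Option (Γ k') → σ) (l l' : Λ) : Stmt Γ Λ σ :=
  pop k (fun _ o => put (o.map e)) <| branch (fun v => (get v).isSome)
    (pushOption k' get <| goto fun _ => l) (goto fun _ => l')

theorem stepAux_move_nil [DecidableEq K] {Γ : K → Type*} {k k' : K} {e : Γ k → Γ k'}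
    {get : σ → Option (Γ k')} {put : Option (Γ k') → σ} {l l' : Λ} {v : σ}
    {S : ∀ k, List (Γ k)} (hget : ∀ o, get (put o) = o) (h : S k = []) :
    stepAux (move k k' e get put l l') v S = ⟨some l', put none, S⟩ := by
  have h' : Function.update S k [] = S := by rw [← h]; exact Function.update_eq_self _ _
  simp [move, h, hget, h']

theorem stepAux_move_cons [DecidableEq K] {Γ : K → Type*} {k k' : K} {e : Γ k → Γ k'}
    {get : σ → Option (Γ k')} {put : Option (Γ k') → σ} {l l' : Λ} {v : σ}
    {S : ∀ k, List (Γ k)} {x : Γ k} {s : List (Γ k)} (hget : ∀ o, get (put o) = o)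
    (h : S k = x :: s) (hk : k' ≠ k) :
    stepAux (move k k' e get put l l') v S =
      ⟨some l, put (some (e x)), Function.update (Function.update S k s) k' (e x :: S k')⟩ := by
  simp [move, h, hget, stepAux_pushOption (hget (some (e x))), hk]

/-- A statement, transferred to a machine with more stacks, labels and states. Instead of halting,
it goes to the label `exit` if there is one. -/
def embed {Γ : K' → Type*} (ι : K → K') (get : σ' → σ) (put : σ → σ') (lab : Λ → Λ')
    (exit : Option Λ') : Stmt (fun k => Γ (ι k)) Λ σ → Stmt Γ Λ' σ'
  | push k f q => push (ι k) (fun v => f (get v)) (embed ι get put lab exit q)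
  | peek k f q => peek (ι k) (fun v o => put (f (get v) o)) (embed ι get put lab exit q)
  | pop k f q => pop (ι k) (fun v o => put (f (get v) o)) (embed ι get put lab exit q)
  | load f q => load (fun v => put (f (get v))) (embed ι get put lab exit q)
  | branch f q₁ q₂ =>
    branch (fun v => f (get v)) (embed ι get put lab exit q₁) (embed ι get put lab exit q₂)
  | goto f => goto fun v => lab (f (get v))
  | halt => exit.elim halt fun l => goto fun _ => l

/-- `emb` fixes the contents of the foreign stacks; `hemb` and `hupd` say that reading and writing
the stacks `ι k` commute with it. Halting turns into the label `exit`, which is how one machine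
hands over to the next. -/
theorem stepAux_embed [DecidableEq K] [DecidableEq K'] {Γ : K' → Type*} {ι : K → K'}
    {get : σ' → σ} {put : σ → σ'} {lab : Λ → Λ'} {exit : Option Λ'}
    {emb : (∀ k, List (Γ (ι k))) → ∀ k', List (Γ k')} (hget : ∀ v, get (put v) = v)
    (hemb : ∀ S k, emb S (ι k) = S k)
    (hupd : ∀ S k x, Function.update (emb S) (ι k) x = emb (Function.update S k x))
    (q : Stmt (fun k => Γ (ι k)) Λ σ) (v : σ) (S : ∀ k, List (Γ (ι k))) :
    stepAux (embed ι get put lab exit q) (put v) (emb S) =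
      ⟨(stepAux q v S).l.elim exit (fun l => some (lab l)), put (stepAux q v S).var,
        emb (stepAux q v S).stk⟩ := by
  induction q generalizing v S with
  | push k f q ih => simp only [embed, stepAux, hget, hemb, hupd, ih]
  | peek k f q ih => simp only [embed, stepAux, hget, hemb, ih]
  | pop k f q ih => simp only [embed, stepAux, hget, hemb, hupd, ih]
  | load f q ih => simp only [embed, stepAux, hget, ih]
  | branch f q₁ q₂ ih₁ ih₂ =>
    simp only [embed, stepAux, hget]
    cases f v
    · exact ih₂ _ _
    · exact ih₁ _ _
  | goto f => simp [embed, hget]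
  | halt => cases exit <;> simp [embed]

end Stmt

end TM2

/-! ### Composition -/

namespace FinTM2

open TM2 TM2.Stmt

variable (tm₁ tm₂ : FinTM2) (e : tm₁.Γ tm₁.k₁ ≃ tm₂.Γ tm₂.k₀)

/-- The stacks of the composition of two machines: the stacks of both, and one auxiliary stack. -/
abbrev compΓ : tm₁.K ⊕ tm₂.K ⊕ Unit → Type :=
  Sum.elim tm₁.Γ (Sum.elim tm₂.Γ fun _ => tm₂.Γ tm₂.k₀)

/-- The content of all stacks of the composition. -/
def compStk (S₁ : ∀ k, List (tm₁.Γ k)) (S₂ : ∀ k, List (tm₂.Γ k)) (t : List (tm₂.Γ tm₂.k₀)) :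
    ∀ k, List (compΓ tm₁ tm₂ k)
  | .inl k => S₁ k
  | .inr (.inl k) => S₂ k
  | .inr (.inr _) => t

variable {tm₁ tm₂}

theorem update_compStk_inl (S₁ : ∀ k, List (tm₁.Γ k)) (S₂ : ∀ k, List (tm₂.Γ k))
    (t : List (tm₂.Γ tm₂.k₀)) (k : tm₁.K) (x : List (tm₁.Γ k)) :
    Function.update (compStk tm₁ tm₂ S₁ S₂ t) (.inl k) x =
      compStk tm₁ tm₂ (Function.update S₁ k x) S₂ t := by
  refine Function.update_eq_iff.2 ⟨(Function.update_self k x S₁).symm, ?_⟩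
  rintro (k' | k' | k') h
  · exact (Function.update_of_ne (fun h' => h (congrArg _ h')) x S₁).symm
  · rfl
  · rfl

theorem update_compStk_inr_inl (S₁ : ∀ k, List (tm₁.Γ k)) (S₂ : ∀ k, List (tm₂.Γ k))
    (t : List (tm₂.Γ tm₂.k₀)) (k : tm₂.K) (x : List (tm₂.Γ k)) :
    Function.update (compStk tm₁ tm₂ S₁ S₂ t) (.inr (.inl k)) x =
      compStk tm₁ tm₂ S₁ (Function.update S₂ k x) t := by
  refine Function.update_eq_iff.2 ⟨(Function.update_self k x S₂).symm, ?_⟩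
  rintro (k' | k' | k') h
  · rfl
  · exact (Function.update_of_ne (fun h' => h (congrArg _ (congrArg _ h'))) x S₂).symm
  · rfl

theorem update_compStk_inr_inr (S₁ : ∀ k, List (tm₁.Γ k)) (S₂ : ∀ k, List (tm₂.Γ k))
    (t x : List (tm₂.Γ tm₂.k₀)) :
    Function.update (compStk tm₁ tm₂ S₁ S₂ t) (.inr (.inr ())) x = compStk tm₁ tm₂ S₁ S₂ x := by
  refine Function.update_eq_iff.2 ⟨rfl, ?_⟩
  rintro (k' | k' | k') h
  · rfl
  · rfl
  · exact absurd rfl h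

variable (tm₁ tm₂)

/-- The program of the composition of two machines: the first machine runs, its output is moved to
the auxiliary stack and then to the input stack of the second machine, and the second machine
runs. -/
def compStmt : tm₁.Λ ⊕ tm₂.Λ ⊕ Bool → TM2.Stmt (compΓ tm₁ tm₂) (tm₁.Λ ⊕ tm₂.Λ ⊕ Bool)
    (tm₁.σ × tm₂.σ × Option (tm₂.Γ tm₂.k₀))
  | .inl l => embed .inl (fun v => v.1) (fun v => (v, tm₂.initialState, none)) .inl
      (some (.inr (.inr false))) (tm₁.m l)
  | .inr (.inl l) => embed (fun k => .inr (.inl k)) (fun v => v.2.1)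
      (fun v => (tm₁.initialState, v, none)) (fun l => .inr (.inl l)) none (tm₂.m l)
  | .inr (.inr false) => move (.inl tm₁.k₁) (.inr (.inr ())) e (fun v => v.2.2)
      (fun o => (tm₁.initialState, tm₂.initialState, o)) (.inr (.inr false)) (.inr (.inr true))
  | .inr (.inr true) => move (.inr (.inr ())) (.inr (.inl tm₂.k₀)) id (fun v => v.2.2)
      (fun o => (tm₁.initialState, tm₂.initialState, o)) (.inr (.inr true))
      (.inr (.inl tm₂.main))

/-- The composition of two machines. -/
def comp : FinTM2 :=
  letI := tm₁.kDecidableEq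
  letI := tm₂.kDecidableEq
  letI := tm₁.kFin
  letI := tm₂.kFin
  letI := tm₁.ΛFin
  letI := tm₂.ΛFin
  letI := tm₁.σFin
  letI := tm₂.σFin
  letI := tm₂.Γk₀Fin
  letI : Fintype (compΓ tm₁ tm₂ (.inl tm₁.k₀)) := tm₁.Γk₀Fin
  { K := tm₁.K ⊕ tm₂.K ⊕ Unit
    k₀ := .inl tm₁.k₀
    k₁ := .inr (.inl tm₂.k₁)
    Γ := compΓ tm₁ tm₂
    Λ := tm₁.Λ ⊕ tm₂.Λ ⊕ Bool
    main := .inl tm₁.main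
    σ := tm₁.σ × tm₂.σ × Option (tm₂.Γ tm₂.k₀)
    initialState := (tm₁.initialState, tm₂.initialState, none)
    m := compStmt tm₁ tm₂ e }

/-- A configuration of the composition. -/
def compCfg (l : Option (tm₁.Λ ⊕ tm₂.Λ ⊕ Bool))
    (v : tm₁.σ × tm₂.σ × Option (tm₂.Γ tm₂.k₀)) (S₁ : ∀ k, List (tm₁.Γ k))
    (S₂ : ∀ k, List (tm₂.Γ k)) (t : List (tm₂.Γ tm₂.k₀)) : (comp tm₁ tm₂ e).Cfg :=
  ⟨l, v, compStk tm₁ tm₂ S₁ S₂ t⟩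

variable {tm₁ tm₂}

/-- A halted configuration of `tm₁` corresponds to the label at which its output starts to be
unloaded, so no extra step is needed for the handover. -/
theorem comp_runsIn_fst {n : ℕ} {c d : tm₁.Cfg} (h : RunsIn tm₁.step n c d) :
    RunsIn (comp tm₁ tm₂ e).step n
      (compCfg tm₁ tm₂ e (c.l.elim (some (.inr (.inr false))) fun l => some (.inl l))
        (c.var, tm₂.initialState, none) c.stk (fun _ => []) [])
      (compCfg tm₁ tm₂ e (d.l.elim (some (.inr (.inr false))) fun l => some (.inl l))
        (d.var, tm₂.initialState, none) d.stk (fun _ => []) []) := by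
  refine h.map (fun c => compCfg tm₁ tm₂ e
    (c.l.elim (some (.inr (.inr false))) fun l => some (.inl l))
    (c.var, tm₂.initialState, none) c.stk (fun _ => []) []) ?_
  rintro ⟨l, v, S⟩ c' hc
  cases l with
  | none => cases hc
  | some l =>
    obtain rfl : stepAux (tm₁.m l) v S = c' := Option.some.inj hc
    exact congrArg some <| stepAux_embed (Γ := compΓ tm₁ tm₂) (ι := .inl)
      (emb := fun S => compStk tm₁ tm₂ S (fun _ => []) [])
      (put := fun v => (v, tm₂.initialState, none)) (fun _ => rfl) (fun _ _ => rfl)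
      (fun S k x => update_compStk_inl _ _ _ _ _) (tm₁.m l) v S

theorem comp_runsIn_snd {n : ℕ} {c d : tm₂.Cfg} (h : RunsIn tm₂.step n c d) :
    RunsIn (comp tm₁ tm₂ e).step n
      (compCfg tm₁ tm₂ e (c.l.elim none fun l => some (.inr (.inl l)))
        (tm₁.initialState, c.var, none) (fun _ => []) c.stk [])
      (compCfg tm₁ tm₂ e (d.l.elim none fun l => some (.inr (.inl l)))
        (tm₁.initialState, d.var, none) (fun _ => []) d.stk []) := by
  refine h.map (fun c => compCfg tm₁ tm₂ e (c.l.elim none fun l => some (.inr (.inl l)))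
    (tm₁.initialState, c.var, none) (fun _ => []) c.stk []) ?_
  rintro ⟨l, v, S⟩ c' hc
  cases l with
  | none => cases hc
  | some l =>
    obtain rfl : stepAux (tm₂.m l) v S = c' := Option.some.inj hc
    exact congrArg some <| stepAux_embed (Γ := compΓ tm₁ tm₂) (ι := fun k => .inr (.inl k))
      (emb := fun S => compStk tm₁ tm₂ (fun _ => []) S [])
      (put := fun v => (tm₁.initialState, v, none)) (fun _ => rfl) (fun _ _ => rfl)
      (fun S k x => update_compStk_inr_inl _ _ _ _ _) (tm₂.m l) v S

theorem stepAux_unload_nil (S₁ : ∀ k, List (tm₁.Γ k)) (S₂ : ∀ k, List (tm₂.Γ k))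
    (t : List (tm₂.Γ tm₂.k₀)) (v : tm₁.σ × tm₂.σ × Option (tm₂.Γ tm₂.k₀))
    (h : S₁ tm₁.k₁ = []) :
    stepAux (compStmt tm₁ tm₂ e (.inr (.inr false))) v (compStk tm₁ tm₂ S₁ S₂ t) =
      ⟨some (.inr (.inr true)), (tm₁.initialState, tm₂.initialState, none),
        compStk tm₁ tm₂ S₁ S₂ t⟩ := by
  rw [compStmt]
  exact stepAux_move_nil (S := compStk tm₁ tm₂ S₁ S₂ t) (fun _ => rfl) h

theorem stepAux_unload_cons (S₁ : ∀ k, List (tm₁.Γ k)) (S₂ : ∀ k, List (tm₂.Γ k))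
    (t : List (tm₂.Γ tm₂.k₀)) (v : tm₁.σ × tm₂.σ × Option (tm₂.Γ tm₂.k₀))
    {x : tm₁.Γ tm₁.k₁} {s : List (tm₁.Γ tm₁.k₁)} (h : S₁ tm₁.k₁ = x :: s) :
    stepAux (compStmt tm₁ tm₂ e (.inr (.inr false))) v (compStk tm₁ tm₂ S₁ S₂ t) =
      ⟨some (.inr (.inr false)), (tm₁.initialState, tm₂.initialState, some (e x)),
        compStk tm₁ tm₂ (Function.update S₁ tm₁.k₁ s) S₂ (e x :: t)⟩ := by
  rw [← update_compStk_inr_inr (S₁ := Function.update S₁ tm₁.k₁ s) (t := t) (x := e x :: t),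
    ← update_compStk_inl (t := t), compStmt]
  exact stepAux_move_cons (S := compStk tm₁ tm₂ S₁ S₂ t) (k := Sum.inl tm₁.k₁)
    (k' := Sum.inr (Sum.inr ())) (x := x) (e := e) (get := fun v => v.2.2)
    (put := fun o => (tm₁.initialState, tm₂.initialState, o)) (fun _ => rfl) h (by simp)

theorem stepAux_load_nil (S₁ : ∀ k, List (tm₁.Γ k)) (S₂ : ∀ k, List (tm₂.Γ k))
    (v : tm₁.σ × tm₂.σ × Option (tm₂.Γ tm₂.k₀)) :
    stepAux (compStmt tm₁ tm₂ e (.inr (.inr true))) v (compStk tm₁ tm₂ S₁ S₂ []) =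
      ⟨some (.inr (.inl tm₂.main)), (tm₁.initialState, tm₂.initialState, none),
        compStk tm₁ tm₂ S₁ S₂ []⟩ := by
  rw [compStmt]
  exact stepAux_move_nil (S := compStk tm₁ tm₂ S₁ S₂ []) (fun _ => rfl) rfl

theorem stepAux_load_cons (S₁ : ∀ k, List (tm₁.Γ k)) (S₂ : ∀ k, List (tm₂.Γ k))
    (v : tm₁.σ × tm₂.σ × Option (tm₂.Γ tm₂.k₀)) (x : tm₂.Γ tm₂.k₀) (t : List (tm₂.Γ tm₂.k₀)) :
    stepAux (compStmt tm₁ tm₂ e (.inr (.inr true))) v (compStk tm₁ tm₂ S₁ S₂ (x :: t)) =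
      ⟨some (.inr (.inr true)), (tm₁.initialState, tm₂.initialState, some x),
        compStk tm₁ tm₂ S₁ (Function.update S₂ tm₂.k₀ (x :: S₂ tm₂.k₀)) t⟩ := by
  rw [← update_compStk_inr_inl, ← update_compStk_inr_inr (t := x :: t) (x := t), compStmt]
  exact stepAux_move_cons (S := compStk tm₁ tm₂ S₁ S₂ (x :: t)) (k := Sum.inr (Sum.inr ()))
    (k' := Sum.inr (Sum.inl tm₂.k₀)) (x := x) (e := id) (get := fun v => v.2.2)
    (put := fun o => (tm₁.initialState, tm₂.initialState, o)) (fun _ => rfl) rfl (by simp)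

/-- Moving a stack reverses it; the second move, `comp_runsIn_load`, restores the order. The
additional step is the pop that finds the stack empty. -/
theorem comp_runsIn_unload (s : List (tm₁.Γ tm₁.k₁)) (t : List (tm₂.Γ tm₂.k₀))
    (o : Option (tm₂.Γ tm₂.k₀)) :
    RunsIn (comp tm₁ tm₂ e).step (s.length + 1)
      (compCfg tm₁ tm₂ e (some (.inr (.inr false))) (tm₁.initialState, tm₂.initialState, o)
        (Function.update (fun _ => []) tm₁.k₁ s) (fun _ => []) t)
      (compCfg tm₁ tm₂ e (some (.inr (.inr true))) (tm₁.initialState, tm₂.initialState, none)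
        (fun _ => []) (fun _ => []) ((s.map e).reverse ++ t)) := by
  induction s generalizing t o with
  | nil =>
    have h : Function.update (fun _ => []) tm₁.k₁ [] = (fun _ => [] : ∀ k, List (tm₁.Γ k)) :=
      Function.update_eq_self _ _
    rw [h]
    exact .head (congrArg some (stepAux_unload_nil e _ _ _ _ rfl)) (.refl _ _)
  | cons x s ih =>
    refine .head (congrArg some (stepAux_unload_cons e _ _ _ _ (Function.update_self _ _ _))) ?_
    rw [Function.update_idem]
    rw [List.map_cons, List.reverse_cons, List.append_assoc]
    exact ih (e x :: t) (some (e x))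

theorem comp_runsIn_load (s t : List (tm₂.Γ tm₂.k₀)) (o : Option (tm₂.Γ tm₂.k₀)) :
    RunsIn (comp tm₁ tm₂ e).step (s.length + 1)
      (compCfg tm₁ tm₂ e (some (.inr (.inr true))) (tm₁.initialState, tm₂.initialState, o)
        (fun _ => []) (Function.update (fun _ => []) tm₂.k₀ t) s)
      (compCfg tm₁ tm₂ e (some (.inr (.inl tm₂.main)))
        (tm₁.initialState, tm₂.initialState, none)
        (fun _ => []) (Function.update (fun _ => []) tm₂.k₀ (s.reverse ++ t)) []) := by
  induction s generalizing t o with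
  | nil => exact .head (congrArg some (stepAux_load_nil e _ _ _)) (.refl _ _)
  | cons x s ih =>
    refine .head (congrArg some (stepAux_load_cons e _ _ _ _ _)) ?_
    rw [Function.update_idem, Function.update_self]
    rw [List.reverse_cons, List.append_assoc]
    exact ih (x :: t) (some x)

theorem initList_comp (s : List (tm₁.Γ tm₁.k₀)) :
    initList (comp tm₁ tm₂ e) s = compCfg tm₁ tm₂ e (some (.inl tm₁.main))
      (tm₁.initialState, tm₂.initialState, none) (initList tm₁ s).stk (fun _ => []) [] := by
  refine (initList_eq (comp tm₁ tm₂ e) s).trans (congrArg (TM2.Cfg.mk (Γ := compΓ tm₁ tm₂) _ _) ?_)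
  rw [initList_eq]
  refine Eq.trans ?_ (update_compStk_inl (fun _ => []) (fun _ => []) [] tm₁.k₀ s)
  refine congrArg (fun S : ∀ k, List (compΓ tm₁ tm₂ k) => Function.update S (.inl tm₁.k₀) s)
    (funext ?_)
  rintro (k | k | k) <;> rfl

theorem haltList_comp (s : List (tm₂.Γ tm₂.k₁)) :
    haltList (comp tm₁ tm₂ e) s = compCfg tm₁ tm₂ e none
      (tm₁.initialState, tm₂.initialState, none) (fun _ => []) (haltList tm₂ s).stk [] := by
  refine (haltList_eq (comp tm₁ tm₂ e) s).trans (congrArg (TM2.Cfg.mk (Γ := compΓ tm₁ tm₂) _ _) ?_)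
  rw [haltList_eq]
  refine Eq.trans ?_ (update_compStk_inr_inl (fun _ => []) (fun _ => []) [] tm₂.k₁ s)
  refine congrArg (fun S : ∀ k, List (compΓ tm₁ tm₂ k) =>
    Function.update S (.inr (.inl tm₂.k₁)) s) (funext ?_)
  rintro (k | k | k) <;> rfl

/-- A bound on the number of symbols pushed in one step. -/
def maxPushes (tm : FinTM2) : ℕ :=
  letI := tm.ΛFin
  ∑ l, (tm.m l).pushes

theorem length_stk_step_le (tm : FinTM2) (k : tm.K) {c d : tm.Cfg} (h : tm.step c = some d) :
    (d.stk k).length ≤ (c.stk k).length + tm.maxPushes := by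
  let _ := tm.ΛFin
  obtain ⟨l, v, S⟩ := c
  cases l with
  | none => cases h
  | some l =>
    obtain rfl : stepAux (tm.m l) v S = d := Option.some.inj h
    exact (length_stepAux_le _ _ _ _).trans <| Nat.add_le_add_left
      (Finset.single_le_sum (f := fun l => (tm.m l).pushes) (fun _ _ => Nat.zero_le _)
        (Finset.mem_univ l)) _

/-- In a composition, the running time of the second machine is polynomial in the length of the
intermediate string, which therefore has to be bounded in terms of the original input. -/
theorem length_output_le (tm : FinTM2) {n : ℕ} {s : List (tm.Γ tm.k₀)} {t : List (tm.Γ tm.k₁)}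
    (h : RunsIn tm.step n (initList tm s) (haltList tm t)) :
    t.length ≤ s.length + tm.maxPushes * n := by
  have key := h.le_add_mul (μ := fun c => (c.stk tm.k₁).length)
    (fun c d h => length_stk_step_le tm tm.k₁ h)
  rw [initList_eq, haltList_eq] at key
  have h₁ : (Function.update (fun _ => []) tm.k₁ t : ∀ k, List (tm.Γ k)) tm.k₁ = t :=
    Function.update_self _ _ _
  -- The output stack may be the input stack; otherwise it is empty at the start.
  have h₀ : ((Function.update (fun _ => []) tm.k₀ s : ∀ k, List (tm.Γ k)) tm.k₁).length ≤
      s.length := by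
    rcases eq_or_ne tm.k₁ tm.k₀ with h | h
    · rw [h, Function.update_self]
    · rw [Function.update_of_ne h]; exact Nat.zero_le _
  simp only [h₁] at key
  omega

end FinTM2

theorem polynomial_eval_mono (p : Polynomial ℕ) : Monotone fun n => p.eval n := by
  intro m n h
  simp only [Polynomial.eval_eq_sum, Polynomial.sum]
  gcongr

/-- The composition of polynomial-time computable functions is polynomial-time computable. -/
theorem TM2ComputableInPolyTime.nonempty_comp {α β γ αΓ βΓ γΓ : Type} {eα : α → List αΓ}
    {eβ : β → List βΓ} {eγ : γ → List γΓ} {f : α → β} {g : β → γ}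
    (h₁ : TM2ComputableInPolyTime eα eβ f) (h₂ : TM2ComputableInPolyTime eβ eγ g) :
    Nonempty (TM2ComputableInPolyTime eα eγ (g ∘ f)) := by
  let e := h₁.outputAlphabet.trans h₂.inputAlphabet.symm
  -- `q` bounds the length of the intermediate string. The summands of the time bound below are for
  -- the first run, the two moves and the second run.
  let q : Polynomial ℕ := .X + .C h₁.tm.maxPushes * h₁.time
  refine nonempty_computableInPolyTime (h₁.tm.comp h₂.tm e) h₁.inputAlphabet h₂.outputAlphabet
    (h₁.time + ((q + 1) + ((q + 1) + h₂.time.comp q))) fun a => ?_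
  have r₁ := h₁.runsIn a
  have r₂ := h₂.runsIn (f a)
  have hlen : (eβ (f a)).length ≤ q.eval (eα a).length := by
    simpa [q] using FinTM2.length_output_le _ r₁
  have t₁ := FinTM2.comp_runsIn_fst e r₁
  have t₂ := FinTM2.comp_runsIn_snd e r₂
  have t₃ := FinTM2.comp_runsIn_unload e ((eβ (f a)).map h₁.outputAlphabet.symm) [] none
  have t₄ := FinTM2.comp_runsIn_load e
    (((eβ (f a)).map h₁.outputAlphabet.symm).map e).reverse [] none
  simp only [initList_eq, haltList_eq, Option.elim] at t₁ t₂
  have hs : ((((eβ (f a)).map h₁.outputAlphabet.symm).map e).reverse.reverse ++ [] :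
      List (h₂.tm.Γ h₂.tm.k₀)) = (eβ (f a)).map h₂.inputAlphabet.symm := by
    simp [e, Function.comp_def]
  rw [hs] at t₄
  rw [List.append_nil] at t₃
  have hmid : (Function.update (fun _ => []) h₂.tm.k₀ [] : ∀ k, List (h₂.tm.Γ k)) =
    fun _ => [] := Function.update_eq_self _ _
  rw [hmid] at t₄
  have t := t₁.trans (t₃.trans (t₄.trans t₂))
  have hi := FinTM2.initList_comp e ((eα a).map h₁.inputAlphabet.symm)
  have ho := FinTM2.haltList_comp e ((eγ (g (f a))).map h₂.outputAlphabet.symm)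
  rw [initList_eq] at hi
  rw [haltList_eq h₂.tm] at ho
  refine (hi ▸ ho ▸ t.mono ?_ :)
  simp only [Polynomial.eval_add, Polynomial.eval_one, Polynomial.eval_comp, List.length_map,
    List.length_reverse]
  have := polynomial_eval_mono h₂.time hlen
  simp only at this
  omega

end Turing

namespace Turing

/-! ### Stack machines -/

/-- A machine with finitely many stacks. At each label it pops a stack and, depending on the symbol
found, pushes a list of symbols (with the stacks they go to) and continues with another label or
stops. -/
structure StackMachine where
  K : Type
  [decEqK : DecidableEq K]
  [fintypeK : Fintype K]
  Γ : K → Type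
  [fintypeΓ : ∀ k, Fintype (Γ k)]
  Λ : Type
  [fintypeΛ : Fintype Λ]
  input : K
  output : K
  main : Λ
  source : Λ → K
  act : ∀ l, Option (Γ (source l)) → List (Σ k, Γ k) × Option Λ

namespace StackMachine

attribute [instance] StackMachine.decEqK StackMachine.fintypeK StackMachine.fintypeΓ
  StackMachine.fintypeΛ

/-- Push a list of symbols. -/
def pushAll {K : Type} [DecidableEq K] {Γ : K → Type} :
    List (Σ k, Γ k) → (∀ k, List (Γ k)) → ∀ k, List (Γ k)
  | [], S => S
  | p :: ps, S => pushAll ps (Function.update S p.1 (p.2 :: S p.1))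

variable (M : StackMachine)

/-- The configurations: the label, if the machine has not stopped, and the stacks. -/
abbrev Cfg : Type := Option M.Λ × ∀ k, List (M.Γ k)

/-- One step of a stack machine. -/
def step : M.Cfg → Option M.Cfg
  | (none, _) => none
  | (some l, S) =>
    some ((M.act l (S (M.source l)).head?).2, pushAll (M.act l (S (M.source l)).head?).1
      (Function.update S (M.source l) (S (M.source l)).tail))

open TM2 TM2.Stmt

section Stmt

variable {K : Type} {Γ : K → Type} {Λ σ : Type}

/-- Push a list of constant symbols. -/
def pushStmt : List (Σ k, Γ k) → TM2.Stmt Γ Λ σ → TM2.Stmt Γ Λ σ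
  | [], q => q
  | p :: ps, q => push p.1 (fun _ => p.2) (pushStmt ps q)

theorem stepAux_pushStmt [DecidableEq K] (ps : List (Σ k, Γ k)) (q : TM2.Stmt Γ Λ σ) (v : σ)
    (S : ∀ k, List (Γ k)) : stepAux (pushStmt ps q) v S = stepAux q v (pushAll ps S) := by
  induction ps generalizing S with
  | nil => rfl
  | cons p ps ih => exact ih _

/-- Pop the stack `k` and branch according to the symbol found. -/
def caseStmt (k : K) (q : Option (Γ k) → TM2.Stmt Γ Λ (Option (Σ k, Γ k))) :
    List (Option (Γ k)) → TM2.Stmt Γ Λ (Option (Σ k, Γ k))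
  | [] => halt
  | o :: os => open Classical in
    branch (fun v => decide (v = o.map (Sigma.mk k))) (q o) (caseStmt k q os)

theorem stepAux_caseStmt [DecidableEq K] (k : K)
    (q : Option (Γ k) → TM2.Stmt Γ Λ (Option (Σ k, Γ k))) (os : List (Option (Γ k)))
    (o : Option (Γ k)) (ho : o ∈ os) (S : ∀ k, List (Γ k)) :
    stepAux (caseStmt k q os) (o.map (Sigma.mk k)) S = stepAux (q o) (o.map (Sigma.mk k)) S := by
  induction os with
  | nil => simp at ho
  | cons o' os ih =>
    by_cases h : o = o'
    · simp [caseStmt, h]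
    · have h' : o.map (Sigma.mk k) ≠ o'.map (Sigma.mk k) := fun h' =>
        h (Option.map_injective sigma_mk_injective h')
      simpa [caseStmt, h'] using ih (List.mem_of_ne_of_mem h ho)

/-- Pop all stacks from a list, recording in the state whether one of them was nonempty. -/
def popStmt : List K → TM2.Stmt Γ Λ (Option (Σ k, Γ k)) → TM2.Stmt Γ Λ (Option (Σ k, Γ k))
  | [], q => q
  | k :: ks, q => pop k (fun v o => v.or (o.map (Sigma.mk k))) (popStmt ks q)

/-- Of the state `v'` only its being `none` matters, which signals that there was nothing to pop.
Without `Nodup`, a stack could lose more than one symbol. -/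
theorem stepAux_popStmt [DecidableEq K] (ks : List K) (hks : ks.Nodup)
    (q : TM2.Stmt Γ Λ (Option (Σ k, Γ k))) (v : Option (Σ k, Γ k)) (S : ∀ k, List (Γ k)) :
    ∃ v', (v' = none ↔ v = none ∧ ∀ k ∈ ks, S k = []) ∧
      stepAux (popStmt ks q) v S =
        stepAux q v' (fun k => if k ∈ ks then (S k).tail else S k) := by
  induction ks generalizing v S with
  | nil => exact ⟨v, by simp, by simp [popStmt]⟩
  | cons k ks ih =>
    obtain ⟨hk, hks⟩ := List.nodup_cons.1 hks
    obtain ⟨v', hv', h⟩ := ih hks (v.or ((S k).head?.map (Sigma.mk k)))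
      (Function.update S k (S k).tail)
    refine ⟨v', ?_, ?_⟩
    · have : ∀ k' ∈ ks, Function.update S k (S k).tail k' = S k' := fun k' hk' =>
        Function.update_of_ne (fun h : k' = k => hk (h ▸ hk')) _ _
      rw [hv']
      simp only [Option.or_eq_none_iff, Option.map_eq_none_iff, List.head?_eq_none_iff,
        List.mem_cons, forall_eq_or_imp, and_assoc]
      refine and_congr_right fun _ => and_congr_right fun _ => forall₂_congr fun k' hk' => ?_
      rw [this k' hk']
    · simp only [popStmt, stepAux]
      rw [h]
      congr 1
      funext k'
      rcases eq_or_ne k' k with rfl | hne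
      · simp [hk]
      · simp [hne]

end Stmt

/-- The statement at the label `l` of the compiled machine. The label `none` is that of the final
loop, which empties all stacks but the output stack. -/
def toStmt : Option M.Λ → TM2.Stmt M.Γ (Option M.Λ) (Option (Σ k, M.Γ k))
  | some l => pop (M.source l) (fun _ o => o.map (Sigma.mk _)) <|
      caseStmt (M.source l) (fun o => pushStmt (M.act l o).1 <| load (fun _ => none) <|
        goto fun _ => (M.act l o).2) Finset.univ.toList
  | none => popStmt (Finset.univ.erase M.output).toList <|
      branch (fun v => v.isSome) (load (fun _ => none) <| goto fun _ => none) halt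

/-- The compiled machine. -/
def toFinTM2 : FinTM2 where
  K := M.K
  k₀ := M.input
  k₁ := M.output
  Γ := M.Γ
  Λ := Option M.Λ
  main := some M.main
  σ := Option (Σ k, M.Γ k)
  initialState := none
  m := M.toStmt

/-- The configuration of the compiled machine that corresponds to a configuration. -/
def toTM2Cfg (c : M.Cfg) : M.toFinTM2.Cfg := ⟨some c.1, none, c.2⟩

theorem runsIn_toFinTM2 {n : ℕ} {c d : M.Cfg} (h : RunsIn M.step n c d) :
    RunsIn M.toFinTM2.step n (M.toTM2Cfg c) (M.toTM2Cfg d) := by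
  refine h.map M.toTM2Cfg ?_
  rintro ⟨l, S⟩ c' hc
  cases l with
  | none => cases hc
  | some l =>
    cases hc
    refine congrArg some ?_
    change stepAux (M.toStmt (some l)) none S = _
    simp only [toStmt, stepAux]
    rw [stepAux_caseStmt _ _ _ _ (by simp), stepAux_pushStmt]
    rfl

theorem initList_toFinTM2 (s : List (M.Γ M.input)) :
    initList M.toFinTM2 s = M.toTM2Cfg (some M.main, Function.update (fun _ => []) M.input s) :=
  initList_eq M.toFinTM2 s

theorem haltList_toFinTM2 (s : List (M.Γ M.output)) :
    haltList M.toFinTM2 s =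
      (⟨none, none, Function.update (fun _ => []) M.output s⟩ : TM2.Cfg _ _ _) :=
  haltList_eq M.toFinTM2 s

/-- A final configuration must have all stacks but the output empty. Each round of the loop shortens
all of them at once, and one further round detects that they are empty. -/
theorem runsIn_cleanup {n : ℕ} (S : ∀ k, List (M.Γ k))
    (hS : ∀ k, k ≠ M.output → (S k).length ≤ n) :
    RunsIn M.toFinTM2.step (n + 1) (M.toTM2Cfg (none, S))
      (haltList M.toFinTM2 (S M.output)) := by
  obtain ⟨v', hv', h⟩ := stepAux_popStmt (Finset.univ.erase M.output).toList
    (Finset.nodup_toList _)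
    (branch (fun v => v.isSome) (load (fun _ => none) <| goto fun _ => none) halt :
      TM2.Stmt M.Γ (Option M.Λ) (Option (Σ k, M.Γ k))) none S
  induction n generalizing S v' with
  | zero =>
    refine .head (congrArg some (h.trans ?_)) (.refl _ _)
    obtain rfl : v' = none := hv'.2 ⟨rfl, fun k hk => by simpa using hS k (by simpa using hk)⟩
    refine Eq.trans ?_ (M.haltList_toFinTM2 _).symm
    refine congrArg (TM2.Cfg.mk (Γ := M.Γ) _ _) (Eq.symm (Function.update_eq_iff.2 ⟨?_, ?_⟩))
    · simp
    · intro k hk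
      have hk' : k ≠ M.output := hk
      simp [hk', List.length_eq_zero_iff.1 (Nat.le_zero.1 (hS k hk'))]
  | succ n ih =>
    by_cases hv : v' = none
    · subst hv
      obtain ⟨-, hS'⟩ := hv'.1 rfl
      refine .head (congrArg some (h.trans ?_)) (.refl _ _)
      refine Eq.trans ?_ (M.haltList_toFinTM2 _).symm
      refine congrArg (TM2.Cfg.mk (Γ := M.Γ) _ _) (Eq.symm (Function.update_eq_iff.2 ⟨?_, ?_⟩))
      · simp
      · intro k hk
        have hk' : k ≠ M.output := hk
        simp [hk', hS' k (by simp [hk'])]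
    · obtain ⟨v, rfl⟩ := Option.ne_none_iff_exists'.1 hv
      let S' : ∀ k, List (M.Γ k) :=
        fun k => if k ∈ (Finset.univ.erase M.output).toList then (S k).tail else S k
      obtain ⟨v₃, hv₃, h₃⟩ := stepAux_popStmt (Finset.univ.erase M.output).toList
        (Finset.nodup_toList _)
        (branch (fun v => v.isSome) (load (fun _ => none) <| goto fun _ => none) halt :
          TM2.Stmt M.Γ (Option M.Λ) (Option (Σ k, M.Γ k))) none S'
      have ho : S' M.output = S M.output := by simp [S']
      refine .head (congrArg some h) ?_
      have := ih S' (fun k hk => by have := hS k hk; simp [S', hk]; omega) v₃ hv₃ h₃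
      rw [ho] at this
      exact this

/-- A function computed by a stack machine in polynomial time is polynomial-time computable. -/
theorem nonempty_computableInPolyTime {α β αΓ βΓ : Type} {ea : α → List αΓ} {eb : β → List βΓ}
    {f : α → β} (ei : M.Γ M.input ≃ αΓ) (eo : M.Γ M.output ≃ βΓ) (time : Polynomial ℕ)
    (h : ∀ a, ∃ S, RunsIn M.step (time.eval (ea a).length)
      (some M.main, Function.update (fun _ => []) M.input ((ea a).map ei.symm)) (none, S) ∧
      S M.output = (eb (f a)).map eo.symm) :
    Nonempty (TM2ComputableInPolyTime ea eb f) := by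
  refine Turing.nonempty_computableInPolyTime M.toFinTM2 ei eo
    -- The second summand pays for the cleanup: each stack holds at most the input plus what was
    -- pushed during the run.
    (time + (.X + .C M.toFinTM2.maxPushes * time + 1)) fun a => ?_
  obtain ⟨S, hrun, hout⟩ := h a
  have run := M.runsIn_toFinTM2 hrun
  have hlen (k : M.K) : (S k).length ≤
      (ea a).length + M.toFinTM2.maxPushes * time.eval (ea a).length := by
    have key := run.le_add_mul (μ := fun c => (c.stk k).length)
      (fun c d h => FinTM2.length_stk_step_le M.toFinTM2 k h)
    refine key.trans (Nat.add_le_add_right ?_ _)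
    simp only [toTM2Cfg]
    rcases eq_or_ne k M.input with rfl | hk
    · rw [Function.update_self]; exact (List.length_map _).le
    · rw [Function.update_of_ne hk]; exact Nat.zero_le _
  have := run.trans (M.runsIn_cleanup S fun k _ => hlen k)
  rw [hout, ← initList_toFinTM2] at this
  exact this.mono (by simp)

end StackMachine

end Turing

namespace SimpleGraph

variable {V V' W : Type*}

/-! ### Locally injective endomorphisms -/

/-- A locally injective endomorphism of a finite connected graph is surjective. -/
theorem Connected.surjective_of_locally_injective [Finite W] {F : SimpleGraph W}
    (hF : F.Connected) {h : W → W} (hom : ∀ x y, F.Adj x y → F.Adj (h x) (h y))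
    (inj : ∀ x y y', F.Adj x y → F.Adj x y' → h y = h y' → y = y') :
    Function.Surjective h := by
  have hit (n : ℕ) : (∀ x y, F.Adj x y → F.Adj (h^[n] x) (h^[n] y)) ∧
      ∀ x y y', F.Adj x y → F.Adj x y' → h^[n] y = h^[n] y' → y = y' := by
    induction n with
    | zero => exact ⟨fun _ _ h => h, fun _ _ _ _ _ h => h⟩
    | succ n ih =>
      simp only [Function.iterate_succ_apply']
      exact ⟨fun x y hxy => hom _ _ (ih.1 x y hxy), fun x y y' hy hy' h =>
        ih.2 x y y' hy hy' (inj _ _ _ (ih.1 _ _ hy) (ih.1 _ _ hy') h)⟩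
  -- Some positive power of a self-map of a finite set is idempotent.
  obtain ⟨m, hm, hidem⟩ : ∃ m, 0 < m ∧ ∀ x, h^[m] (h^[m] x) = h^[m] x := by
    obtain ⟨i, j, hij, h'⟩ : ∃ i j, i < j ∧ h^[i] = h^[j] := by
      obtain ⟨i, j, hij, h'⟩ := Finite.exists_ne_map_eq_of_infinite fun n : ℕ => h^[n]
      rcases hij.lt_or_gt with hlt | hlt
      exacts [⟨i, j, hlt, h'⟩, ⟨j, i, hlt, h'.symm⟩]
    have period (n k : ℕ) (hn : i ≤ n) : h^[n + k * (j - i)] = h^[n] := by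
      induction k with
      | zero => simp
      | succ k ih =>
        rw [← ih, show n + (k + 1) * (j - i) = (n + k * (j - i) - i) + j by
          rw [Nat.succ_mul]; omega, Function.iterate_add, ← h', ← Function.iterate_add]
        congr 1
        omega
    -- A positive multiple of the period `j - i` that is at least the preperiod `i`.
    refine ⟨(i + 1) * (j - i), Nat.mul_pos (by omega) (by omega), fun x => ?_⟩
    rw [← Function.iterate_add_apply, period]
    have := Nat.le_mul_of_pos_right (i + 1) (show 0 < j - i by omega)
    omega
  intro z
  by_contra hz
  push Not at hz
  have hz' : z ∉ Set.range h^[m] := by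
    rintro ⟨x, rfl⟩
    obtain ⟨m, rfl⟩ := Nat.exists_eq_succ_of_ne_zero hm.ne'
    exact hz _ (Function.iterate_succ_apply' h m x).symm
  -- A walk from a point of the range of `h^[m]` to `z` leaves the range along some edge xy. By
  -- idempotence `h^[m]` fixes x, so y and `h^[m] y` are neighbours of x with the same image under
  -- `h^[m]`. Local injectivity makes them equal, so y is in the range after all.
  obtain ⟨w⟩ := hF.preconnected (h^[m] z) z
  obtain ⟨d, -, hd, hd'⟩ := w.exists_boundary_dart (Set.range h^[m]) ⟨z, rfl⟩ hz'
  obtain ⟨x, hx⟩ := hd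
  have hfix : h^[m] d.fst = d.fst := by rw [← hx, hidem]
  have hadj := (hit m).1 _ _ d.adj
  rw [hfix] at hadj
  exact hd' ⟨d.snd, (hit m).2 _ _ _ hadj d.adj (hidem _)⟩

/-! ### Domination and isolation numbers -/

theorem dominationNum_le_iff [Finite V] {G : SimpleGraph V} {t : ℕ} :
    G.dominationNum ≤ t ↔ ∃ D : Finset V, G.IsDominatingSet D ∧ D.card ≤ t := by
  have := Fintype.ofFinite V
  have hne : {k | ∃ D : Finset V, G.IsDominatingSet D ∧ D.card = k}.Nonempty :=
    ⟨_, Finset.univ, Set.eq_univ_of_forall fun v => Or.inl (Finset.mem_univ v), rfl⟩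
  constructor
  · intro h
    obtain ⟨D, hD, hk⟩ := Nat.sInf_mem hne
    exact ⟨D, hD, hk.trans_le h⟩
  · rintro ⟨D, hD, h⟩
    exact le_trans (Nat.sInf_le (Exists.intro D ⟨hD, rfl⟩)) h

theorem isolationNum_le_iff [Finite V] [Nonempty W] {G : SimpleGraph V} {F : SimpleGraph W}
    {t : ℕ} :
    G.isolationNum F ≤ t ↔ ∃ D : Finset V, G.IsIsolatingSet F D ∧ D.card ≤ t := by
  have := Fintype.ofFinite V
  have hne : {k | ∃ D : Finset V, G.IsIsolatingSet F D ∧ D.card = k}.Nonempty :=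
    ⟨_, Finset.univ, fun f => ⟨Classical.arbitrary W, Or.inl (Finset.mem_univ _)⟩, rfl⟩
  constructor
  · intro h
    obtain ⟨D, hD, hk⟩ := Nat.sInf_mem hne
    exact ⟨D, hD, hk.trans_le h⟩
  · rintro ⟨D, hD, h⟩
    exact le_trans (Nat.sInf_le (Exists.intro D ⟨hD, rfl⟩)) h

/-- A locally checkable certificate for `F`-isolation: a labelling of the vertices of `G` by
vertices of `F` such that the vertices labelled `u` lie in `N[D]`, and such that the labelling is a
locally injective homomorphism to `F` on the remaining vertices. -/
def IsIsolationLabelling (G : SimpleGraph V) (F : SimpleGraph W) (u : W) (D : Finset V)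
    (l : V → W) : Prop :=
  (∀ x, l x = u → x ∈ G.closedNbhd D) ∧
    ∀ x, l x ≠ u → ∀ y, G.Adj x y → l y ≠ u → F.Adj (l x) (l y) ∧
      ∀ y', G.Adj x y' → l y' = l y → y' = y

/-- Soundness of certificates, for an arbitrary graph G: on a copy of F avoiding N[D] no vertex has
label u, so the labels would give a locally injective endomorphism of F that is not surjective. -/
theorem IsIsolationLabelling.isIsolatingSet [Finite W] {G : SimpleGraph V} {F : SimpleGraph W}
    {u : W} {D : Finset V} {l : V → W} (hF : F.Connected)
    (h : G.IsIsolationLabelling F u D l) : G.IsIsolatingSet F D := by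
  intro f
  by_contra! hf
  have hu (x : W) : l (f x) ≠ u := fun hx => hf x (h.1 _ hx)
  have hadj {x y : W} (hxy : F.Adj x y) : G.Adj (f x) (f y) := f.toHom.map_adj hxy
  obtain ⟨x, hx⟩ := hF.surjective_of_locally_injective (h := fun x => l (f x))
    (fun x y hxy => (h.2 _ (hu x) _ (hadj hxy) (hu y)).1)
    (fun x y y' hy hy' heq =>
      f.injective ((h.2 _ (hu x) _ (hadj hy') (hu y')).2 _ (hadj hy) heq)) u
  exact hu x hx

theorem IsIsolationLabelling.comap {G : SimpleGraph V} {G' : SimpleGraph V'} {F : SimpleGraph W}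
    {u : W} {D : Finset V'} {l : V' → W} (φ : G ≃g G') (h : G'.IsIsolationLabelling F u D l) :
    G.IsIsolationLabelling F u (D.map φ.symm.toEquiv.toEmbedding) (l ∘ φ) := by
  refine ⟨fun x hx => ?_, fun x hx y hy hly => ?_⟩
  · rcases h.1 _ hx with hD | ⟨d, hD, hd⟩
    · exact Or.inl (Finset.mem_map.2 ⟨_, hD, by simp⟩)
    · exact Or.inr ⟨φ.symm d, Finset.mem_map.2 ⟨_, hD, rfl⟩, by
        rw [← φ.map_adj_iff]; simpa using hd⟩
  · obtain ⟨h₁, h₂⟩ := h.2 _ hx _ (φ.map_adj_iff.2 hy) hly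
    exact ⟨h₁, fun y' hy' hl => φ.injective (h₂ _ (φ.map_adj_iff.2 hy') hl)⟩

/-- The edges that come from G join vertices labelled u and are exempt from the condition. All other
edges stay within one attached copy, on which the labelling is an isomorphism to F. -/
theorem IsDominatingSet.isIsolationLabelling {G : SimpleGraph V} {D : Finset V}
    (hD : G.IsDominatingSet D) (F : SimpleGraph W) (u : W) :
    (G.attachCopies F u).IsIsolationLabelling F u
      (D.map ⟨fun v => (v, u), fun _ _ h => congrArg Prod.fst h⟩) Prod.snd := by
  refine ⟨?_, ?_⟩
  · rintro ⟨x, w⟩ rfl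
    have hx : x ∈ G.closedNbhd D := hD ▸ Set.mem_univ x
    rcases hx with hx | ⟨d, hd, hdx⟩
    · exact Or.inl (Finset.mem_map.2 ⟨x, hx, rfl⟩)
    · exact Or.inr ⟨(d, w), Finset.mem_map.2 ⟨d, hd, rfl⟩, Or.inr ⟨rfl, rfl, hdx⟩⟩
  · rintro ⟨x, w⟩ hw ⟨y, w'⟩ (⟨h₁, h₂⟩ | ⟨h, -⟩) hw'
    · refine ⟨h₂, ?_⟩
      rintro ⟨z, w₃⟩ (⟨h₃, -⟩ | ⟨h, -⟩) h₅
      · exact Prod.ext (h₃.symm.trans h₁) h₅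
      · exact absurd h hw
    · exact absurd h hw

/-- Apply the isolation property to the copy attached at `v`: the element of D that is responsible
projects to `v` or to a neighbour of `v`. -/
theorem IsIsolatingSet.isDominatingSet_image [DecidableEq V] {G : SimpleGraph V}
    {F : SimpleGraph W} {u : W} {D : Finset (V × W)}
    (hD : (G.attachCopies F u).IsIsolatingSet F D) :
    G.IsDominatingSet (D.image Prod.fst) := by
  refine Set.eq_univ_of_forall fun v => ?_
  let f : F.Copy (G.attachCopies F u) :=
    ⟨⟨fun w => (v, w), fun h => Or.inl ⟨rfl, h⟩⟩, fun _ _ h => congrArg Prod.snd h⟩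
  obtain ⟨x, hx | ⟨d, hd, hx⟩⟩ := hD f
  · exact Or.inl (Finset.mem_image.2 ⟨_, hx, rfl⟩)
  · rcases hx with ⟨h, -⟩ | ⟨-, -, h⟩
    · exact Or.inl (Finset.mem_image.2 ⟨_, hd, h⟩)
    · exact Or.inr ⟨d.1, Finset.mem_image.2 ⟨_, hd, rfl⟩, h⟩

theorem IsIsolatingSet.map {G : SimpleGraph V} {G' : SimpleGraph V'} {F : SimpleGraph W}
    {D : Finset V} (φ : G ≃g G') (h : G.IsIsolatingSet F D) :
    G'.IsIsolatingSet F (D.map φ.toEquiv.toEmbedding) := by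
  intro f
  obtain ⟨x, hx⟩ := h (φ.symm.toCopy.comp f)
  refine ⟨x, ?_⟩
  have hfx : f x = φ ((φ.symm.toCopy.comp f) x) := by simp
  rw [hfx]
  rcases hx with hx | ⟨d, hd, hx⟩
  · exact Or.inl (Finset.mem_map.2 ⟨_, hx, rfl⟩)
  · exact Or.inr ⟨φ d, Finset.mem_map.2 ⟨_, hd, rfl⟩, φ.map_adj_iff.2 hx⟩

section

variable {G : SimpleGraph V} {H : SimpleGraph V'} {F : SimpleGraph W} {u : W}

theorem dominationNum_le_of_isolationNum_le [Finite V] [Finite V']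
    (φ : H ≃g G.attachCopies F u) {t : ℕ}
    (h : H.isolationNum F ≤ t) : G.dominationNum ≤ t := by
  classical
  have : Nonempty W := ⟨u⟩
  obtain ⟨D, hD, hc⟩ := isolationNum_le_iff.1 h
  exact dominationNum_le_iff.2 ⟨_, (hD.map φ).isDominatingSet_image,
    Finset.card_image_le.trans (by simpa using hc)⟩

theorem exists_labelling_of_dominationNum_le [Finite V] (φ : H ≃g G.attachCopies F u) {t : ℕ}
    (h : G.dominationNum ≤ t) :
    ∃ (D : Finset V') (l : V' → W), H.IsIsolationLabelling F u D l ∧ D.card ≤ t := by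
  obtain ⟨D, hD, hc⟩ := dominationNum_le_iff.1 h
  exact ⟨_, _, (hD.isIsolationLabelling F u).comap φ, by simpa using hc⟩

/-- Completeness of certificates passes through γ(G): the given isolating set is replaced by one
consisting of vertices of G, for which the canonical labelling is valid. -/
theorem isolationNum_le_iff_exists_labelling [Finite V] [Finite V'] [Finite W]
    (hF : F.Connected) (φ : H ≃g G.attachCopies F u)
    {t : ℕ} : H.isolationNum F ≤ t ↔
      ∃ (D : Finset V') (l : V' → W), H.IsIsolationLabelling F u D l ∧ D.card ≤ t := by
  have : Nonempty W := ⟨u⟩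
  exact ⟨fun h => exists_labelling_of_dominationNum_le φ (dominationNum_le_of_isolationNum_le φ h),
    fun ⟨D, l, h, hc⟩ => isolationNum_le_iff.2 ⟨D, h.isIsolatingSet hF, hc⟩⟩

/-- The `F`-isolation number of `C(G, F)` is the domination number of `G`. -/
theorem isolationNum_eq_dominationNum [Finite V] [Finite V'] [Finite W]
    (hF : F.Connected) (φ : H ≃g G.attachCopies F u) :
    H.isolationNum F = G.dominationNum :=
  le_antisymm ((isolationNum_le_iff_exists_labelling hF φ).2
      (exists_labelling_of_dominationNum_le φ le_rfl))
    (dominationNum_le_of_isolationNum_le φ le_rfl)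

end

/-- Attaching isomorphic graphs to isomorphic graphs yields isomorphic graphs. -/
def attachCopiesIso {W' : Type*} {G : SimpleGraph V} {G' : SimpleGraph V'} {F : SimpleGraph W}
    {F' : SimpleGraph W'} (φ : G ≃g G') (ψ : F ≃g F') (u : W) :
    G.attachCopies F u ≃g G'.attachCopies F' (ψ u) where
  toEquiv := φ.toEquiv.prodCongr ψ.toEquiv
  map_rel_iff' := by
    rintro ⟨v, w⟩ ⟨v', w'⟩
    simp [attachCopies, φ.map_adj_iff, ψ.map_adj_iff]

end SimpleGraph

/-! ### Single steps of stack machines -/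

namespace Turing.StackMachine

variable {M : StackMachine}

/-- With the stacks compared pointwise, a step of a concrete machine is verified by cases on the
stack, each closed by `rfl`. -/
theorem runsIn_head {n : ℕ} {l : M.Λ} {l' : Option M.Λ} {S S' : ∀ k, List (M.Γ k)}
    {ps : List (Σ k, M.Γ k)} {c : M.Cfg} (hact : M.act l (S (M.source l)).head? = (ps, l'))
    (hS : ∀ k, pushAll ps (Function.update S (M.source l) (S (M.source l)).tail) k = S' k)
    (h : RunsIn M.step n (l', S') c) : RunsIn M.step (n + 1) (some l, S) c := by
  refine .head ?_ h
  simp only [step, hact, Option.some.injEq, Prod.mk.injEq, true_and]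
  exact funext hS

theorem pushAll_map {K X : Type} [DecidableEq K] {Γ : K → Type} (k : K) (f : X → Γ k) (xs : List X)
    (S : ∀ k, List (Γ k)) :
    pushAll (xs.map fun x => ⟨k, f x⟩) S =
      Function.update S k (xs.reverse.map f ++ S k) := by
  induction xs generalizing S with
  | nil => simp [pushAll]
  | cons x xs ih => simp [pushAll, ih]

end Turing.StackMachine

/-! ### A machine that attaches copies -/

namespace AttachMachine

open Turing.StackMachine

/-- The stacks: the input, the reversed input with the diagonal of the matrix marked, two for the
position of the diagonal, two for a row of the matrix, and the output. -/
inductive Stack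
  | inp | rev | diag | diag' | row | row' | out
  deriving DecidableEq

instance : Fintype Stack :=
  ⟨{.inp, .rev, .diag, .diag', .row, .row', .out}, by rintro ⟨⟩ <;> simp⟩

/-- The stack alphabets. -/
abbrev Γ : Stack → Type
  | .inp => Option Bool ⊕ Bool
  | .rev => Option (Bool × Bool) ⊕ Bool
  | .diag => Bool
  | .diag' => Bool
  | .row => Bool × Bool
  | .row' => Bool × Bool
  | .out => Option Bool ⊕ Bool

instance : ∀ k, Fintype (Γ k)
  | .inp => inferInstanceAs (Fintype (Option Bool ⊕ Bool))
  | .rev => inferInstanceAs (Fintype (Option (Bool × Bool) ⊕ Bool))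
  | .diag => inferInstanceAs (Fintype Bool)
  | .diag' => inferInstanceAs (Fintype Bool)
  | .row => inferInstanceAs (Fintype (Bool × Bool))
  | .row' => inferInstanceAs (Fintype (Bool × Bool))
  | .out => inferInstanceAs (Fintype (Option Bool ⊕ Bool))

/-- The content of all stacks. -/
def stk (inp : List (Option Bool ⊕ Bool)) (rev : List (Option (Bool × Bool) ⊕ Bool))
    (diag diag' : List Bool) (row row' : List (Bool × Bool)) (out : List (Option Bool ⊕ Bool)) :
    ∀ k, List (Γ k)
  | .inp => inp
  | .rev => rev
  | .diag => diag
  | .diag' => diag'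
  | .row => row
  | .row' => row'
  | .out => out

/-- The labels. -/
inductive Label (m : ℕ)
  | start | read | mark (b : Bool) | restore | write | load | forth (w : Fin (m + 1))
  | back (w : Fin (m + 1)) | clear
  deriving Fintype

variable {m : ℕ}

/-- The stack that is popped at a label. -/
abbrev source : Label m → Stack
  | .start => .diag
  | .read => .inp
  | .mark _ => .diag
  | .restore => .diag'
  | .write => .rev
  | .load => .rev
  | .forth _ => .row
  | .back _ => .row'
  | .clear => .row

/-- The action of the machine. In a first phase, the input is moved to the stack `rev`, and the
entries on the diagonal are marked. In a second phase, for each row of the matrix and each `w`, a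
row is written in which the entry `x` is expanded to `entry w x`. -/
def act (entry : Fin (m + 1) → Bool × Bool → List Bool) :
    ∀ l : Label m, Option (Γ (source l)) → List (Σ k, Γ k) × Option (Label m)
  | .start, _ => ([⟨.diag, true⟩], some .read)
  | .read, none => ([], some .write)
  | .read, some (.inr b) => ([⟨.rev, .inr b⟩], some .read)
  | .read, some (.inl none) => ([⟨.rev, .inl none⟩], some .restore)
  | .read, some (.inl (some b)) => ([], some (.mark b))
  | .mark b, none => ([⟨.rev, .inl (some (b, false))⟩], some .read)
  | .mark b, some d => ([⟨.rev, .inl (some (b, d))⟩, ⟨.diag', d⟩], some .read)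
  -- The new `false` moves the mark by one column: during row i the stack `diag` holds i times
  -- `false`, then `true`.
  | .restore, none => ([⟨.diag, false⟩], some .read)
  | .restore, some d => ([⟨.diag, d⟩], some .restore)
  | .write, none => ([], none)
  | .write, some (.inr b) => ([⟨.out, .inr b⟩], some .write)
  | .write, some (.inl none) => ([], some .load)
  | .write, some (.inl (some _)) => ([], none)
  | .load, some (.inl (some x)) => ([⟨.row, x⟩], some .load)
  | .load, some (.inl none) => ([⟨.rev, .inl none⟩], some (.forth (Fin.last m)))
  | .load, some (.inr b) => ([⟨.rev, .inr b⟩], some (.forth (Fin.last m)))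
  | .load, none => ([], some (.forth (Fin.last m)))
  | .forth w, some x => ([⟨.row', x⟩], some (.forth w))
  -- The output is written from its end to its beginning, so the separator precedes the entries.
  | .forth w, none => ([⟨.out, .inl none⟩], some (.back w))
  | .back w, some x =>
    (⟨.row, x⟩ :: (entry w x).reverse.map (fun b => ⟨.out, .inl (some b)⟩), some (.back w))
  | .back ⟨0, _⟩, none => ([], some .clear)
  | .back ⟨w + 1, h⟩, none => ([], some (.forth ⟨w, Nat.lt_of_succ_lt h⟩))
  | .clear, some _ => ([], some .clear)
  | .clear, none => ([], some .write)

/-- The machine. -/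
def machine (entry : Fin (m + 1) → Bool × Bool → List Bool) : StackMachine where
  K := Stack
  Γ := Γ
  Λ := Label m
  input := .inp
  output := .out
  main := .start
  source := source
  act := act entry

variable {entry : Fin (m + 1) → Bool × Bool → List Bool}

/-- Pair the entries of a row with the flags in a list, padded with `false`. -/
def annotate : List Bool → List Bool → List (Bool × Bool)
  | [], _ => []
  | b :: r, [] => (b, false) :: annotate r []
  | b :: r, d :: ds => (b, d) :: annotate r ds

/-- Annotate each row, moving the flags by one position from row to row. -/
def annotateRows : List Bool → List (List Bool) → List (List (Bool × Bool))
  | _, [] => []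
  | ds, r :: rs => annotate r ds :: annotateRows (false :: ds) rs

/-- A row followed by a separator. -/
def encodeRow {X : Type} (r : List X) : List (Option X ⊕ Bool) :=
  r.map (fun b => .inl (some b)) ++ [.inl none]

/-- The rows, each followed by a separator. -/
def encodeRows {X : Type} (rs : List (List X)) : List (Option X ⊕ Bool) :=
  (rs.map encodeRow).flatten

theorem run_read_entries (r : List Bool) (inp rev diag diag' row row' out)
    (h : diag.length ≤ r.length) :
    RunsIn (machine entry).step (2 * r.length)
      (some .read, stk (r.map (fun b => .inl (some b)) ++ inp) rev diag diag' row row' out)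
      (some .read, stk inp (((annotate r diag).map fun x => .inl (some x)).reverse ++ rev) []
        (diag.reverse ++ diag') row row' out) := by
  induction r generalizing rev diag diag' with
  | nil =>
    obtain rfl := List.length_eq_zero_iff.1 (Nat.le_zero.1 h)
    exact .refl _ _
  | cons b r ih =>
    cases diag with
    | nil =>
      simp only [annotate, List.map_cons, List.reverse_cons, List.append_assoc]
      exact runsIn_head (n := 2 * r.length + 1) rfl (fun _ => rfl) <|
        runsIn_head rfl (by rintro ⟨⟩ <;> rfl) (ih _ [] diag' (by simp))
    | cons d diag =>
      simp only [annotate, List.map_cons, List.reverse_cons, List.append_assoc]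
      exact runsIn_head (n := 2 * r.length + 1) rfl (fun _ => rfl) <|
        runsIn_head rfl (by rintro ⟨⟩ <;> rfl) (ih _ diag (d :: diag') (by simpa using h))

theorem run_restore (inp rev diag diag' row row' out) :
    RunsIn (machine entry).step (diag'.length + 1)
      (some .restore, stk inp rev diag diag' row row' out)
      (some .read, stk inp rev (false :: (diag'.reverse ++ diag)) [] row row' out) := by
  induction diag' generalizing diag with
  | nil => exact runsIn_head rfl (by rintro ⟨⟩ <;> rfl) (.refl _ _)
  | cons d diag' ih =>
    rw [List.reverse_cons, List.append_assoc]
    exact runsIn_head rfl (by rintro ⟨⟩ <;> rfl) (ih (d :: diag))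

theorem length_encodeRow {X : Type} (r : List X) : (encodeRow r).length = r.length + 1 := by
  simp [encodeRow]

theorem length_annotate (r ds : List Bool) : (annotate r ds).length = r.length := by
  induction r generalizing ds with
  | nil => rfl
  | cons b r ih => cases ds <;> simp [annotate, ih]

theorem run_read_row (r : List Bool) (inp rev diag row row' out)
    (h : diag.length ≤ r.length) :
    RunsIn (machine entry).step (3 * (encodeRow r).length)
      (some .read, stk (encodeRow r ++ inp) rev diag [] row row' out)
      (some .read, stk inp ((encodeRow (annotate r diag)).reverse ++ rev) (false :: diag) []
        row row' out) := by
  have h₁ := run_read_entries (entry := entry) r (.inl none :: inp) rev diag [] row row' out h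
  have h₂ := run_restore (entry := entry) inp
    (.inl none :: (((annotate r diag).map fun x => .inl (some x)).reverse ++ rev)) []
    (diag.reverse ++ []) row row' out
  have h₃ := h₁.trans (runsIn_head rfl (by rintro ⟨⟩ <;> rfl) h₂)
  have h₄ : (diag.reverse ++ []).reverse ++ [] = diag := by simp
  rw [h₄] at h₃
  simp only [encodeRow, List.reverse_append, List.append_assoc]
  refine h₃.mono ?_
  simp
  omega

/-- The flags must fit into each row in order to be used up at its end, and they grow by one per
row. Starting from `[true]` with n rows of length n, the bound holds with equality. -/
theorem run_read_rows (rs : List (List Bool)) (n : ℕ) (inp rev diag row row' out)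
    (hrs : ∀ r ∈ rs, r.length = n) (h : diag.length + rs.length ≤ n + 1) :
    ∃ diag', RunsIn (machine entry).step (3 * (encodeRows rs).length)
      (some .read, stk (encodeRows rs ++ inp) rev diag [] row row' out)
      (some .read, stk inp ((encodeRows (annotateRows diag rs)).reverse ++ rev) diag' []
        row row' out) := by
  induction rs generalizing rev diag with
  | nil => exact ⟨diag, .refl _ _⟩
  | cons r rs ih =>
    simp only [List.mem_cons, forall_eq_or_imp, List.length_cons] at hrs h
    obtain ⟨diag', ih⟩ := ih ((encodeRow (annotate r diag)).reverse ++ rev) (false :: diag) hrs.2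
      (by simp; omega)
    have h₁ := run_read_row (entry := entry) r (encodeRows rs ++ inp) rev diag row row' out
      (by omega)
    have h₂ := h₁.trans ih
    refine ⟨diag', ?_⟩
    simp only [encodeRows, annotateRows, List.map_cons, List.flatten_cons, List.append_assoc,
      List.reverse_append, List.length_append, Nat.mul_add] at h₂ ⊢
    exact h₂

theorem run_read_suffix (t : List Bool) (rev diag diag' row row' out) :
    RunsIn (machine entry).step (t.length + 1)
      (some .read, stk (t.map .inr) rev diag diag' row row' out)
      (some .write, stk [] (t.reverse.map .inr ++ rev) diag diag' row row' out) := by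
  induction t generalizing rev with
  | nil => exact runsIn_head rfl (by rintro ⟨⟩ <;> rfl) (.refl _ _)
  | cons b t ih =>
    simp only [List.reverse_cons, List.map_append, List.append_assoc]
    exact runsIn_head rfl (by rintro ⟨⟩ <;> rfl) (ih (.inr b :: rev))

theorem run_write_suffix (t : List Bool) (inp rev diag diag' row row' out) :
    RunsIn (machine entry).step t.length
      (some .write, stk inp (t.map .inr ++ rev) diag diag' row row' out)
      (some .write, stk inp rev diag diag' row row' (t.reverse.map .inr ++ out)) := by
  induction t generalizing out with
  | nil => exact .refl _ _
  | cons b t ih =>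
    simp only [List.reverse_cons, List.map_append, List.append_assoc]
    exact runsIn_head rfl (by rintro ⟨⟩ <;> rfl) (ih (.inr b :: out))

/-- The start of a row is recognised by the separator of the row before it, which is put back, or by
the bottom of the stack. -/
theorem run_load (r : List (Bool × Bool)) (inp rev diag diag' row row' out)
    (hrev : rev = [] ∨ ∃ rev', rev = .inl none :: rev') :
    RunsIn (machine entry).step (r.length + 1)
      (some .load, stk inp (r.map (fun x => .inl (some x)) ++ rev) diag diag' row row' out)
      (some (.forth (Fin.last m)), stk inp rev diag diag' (r.reverse ++ row) row' out) := by
  induction r generalizing row with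
  | nil =>
    obtain rfl | ⟨rev', rfl⟩ := hrev
    · exact runsIn_head rfl (by rintro ⟨⟩ <;> rfl) (.refl _ _)
    · exact runsIn_head rfl (by rintro ⟨⟩ <;> rfl) (.refl _ _)
  | cons b r ih =>
    simp only [List.reverse_cons, List.append_assoc]
    exact runsIn_head rfl (by rintro ⟨⟩ <;> rfl) (ih (b :: row))

theorem run_forth (w : Fin (m + 1)) (inp rev diag diag' row row' out) :
    RunsIn (machine entry).step (row.length + 1)
      (some (.forth w), stk inp rev diag diag' row row' out)
      (some (.back w), stk inp rev diag diag' [] (row.reverse ++ row') (.inl none :: out)) := by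
  induction row generalizing row' with
  | nil => exact runsIn_head rfl (by rintro ⟨⟩ <;> rfl) (.refl _ _)
  | cons b r ih =>
    simp only [List.reverse_cons, List.append_assoc]
    exact runsIn_head rfl (by rintro ⟨⟩ <;> rfl) (ih (b :: row'))

theorem run_back (w : Fin (m + 1)) (inp rev diag diag' row row' out) :
    RunsIn (machine entry).step row'.length
      (some (.back w), stk inp rev diag diag' row row' out)
      (some (.back w), stk inp rev diag diag' (row'.reverse ++ row) []
        ((row'.reverse.flatMap (entry w)).map (fun b => .inl (some b)) ++ out)) := by
  induction row' generalizing row out with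
  | nil => exact .refl _ _
  | cons x r ih =>
    simp only [List.reverse_cons, List.append_assoc, List.flatMap_append, List.map_append,
      List.flatMap_singleton]
    refine runsIn_head (ps := (⟨.row, x⟩ ::
      (entry w x).reverse.map (fun b => ⟨.out, .inl (some b)⟩) : List (Σ k, Γ k))) rfl ?_
      (ih (x :: row) ((entry w x).map (fun b => Sum.inl (some b)) ++ out))
    have h := pushAll_map (Γ := Γ) .out (fun b : Bool => .inl (some b)) (entry w x).reverse
      (stk inp rev diag diag' (x :: row) r out)
    rw [List.reverse_reverse] at h
    have h' : Function.update (Function.update (stk inp rev diag diag' row (x :: r) out)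
        .row' r) .row (x :: row) = stk inp rev diag diag' (x :: row) r out := by
      funext k
      cases k <;> rfl
    intro k
    refine (congrFun (congrArg (pushAll _) h') k).trans ((congrFun h k).trans ?_)
    cases k <;> rfl

theorem run_clear (inp rev diag diag' row row' out) :
    RunsIn (machine entry).step (row.length + 1)
      (some .clear, stk inp rev diag diag' row row' out)
      (some .write, stk inp rev diag diag' [] row' out) := by
  induction row with
  | nil => exact runsIn_head rfl (by rintro ⟨⟩ <;> rfl) (.refl _ _)
  | cons b r ih => exact runsIn_head rfl (by rintro ⟨⟩ <;> rfl) ih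

/-- The lines that are written for the row `r`, up to line `w`. -/
def expandRow (entry : Fin (m + 1) → Bool × Bool → List Bool) (r : List (Bool × Bool)) :
    List (List Bool) :=
  List.ofFn fun w => r.flatMap (entry w)

/-- Lines are written in the order w, …, 0, each in front of the previous ones. Going to `row'` and
back leaves `row` intact for the next line. -/
theorem run_copies (w : ℕ) (hw : w < m + 1) (inp rev diag diag' row out) :
    RunsIn (machine entry).step ((w + 1) * (2 * (row.length + 1)))
      (some (.forth ⟨w, hw⟩), stk inp rev diag diag' row [] out)
      (some .clear, stk inp rev diag diag' row [] (encodeRows (List.ofFn fun i : Fin (w + 1) =>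
        row.flatMap (entry (i.castLE hw))) ++ out)) := by
  induction w generalizing out with
  | zero =>
    have h₁ := run_forth (entry := entry) ⟨0, hw⟩ inp rev diag diag' row [] out
    have h₂ := run_back (entry := entry) ⟨0, hw⟩ inp rev diag diag' [] (row.reverse ++ [])
      (.inl none :: out)
    have h (row out) : RunsIn (machine entry).step 1
        (some (.back ⟨0, hw⟩), stk inp rev diag diag' row [] out)
        (some .clear, stk inp rev diag diag' row [] out) :=
      runsIn_head rfl (by rintro ⟨⟩ <;> rfl) (.refl _ _)
    have h₃ := (h₁.trans h₂).trans (h _ _)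
    simp only [List.append_nil, List.reverse_reverse, List.length_reverse] at h₃
    refine RunsIn.mono ?_ (Nat.le_of_eq ?_) (m := row.length + 1 + row.length + 1)
    · simpa [encodeRows, encodeRow] using h₃
    · omega
  | succ w ih =>
    have hw' : w < m + 1 := Nat.lt_of_succ_lt hw
    have h₁ := run_forth (entry := entry) ⟨w + 1, hw⟩ inp rev diag diag' row [] out
    have h₂ := run_back (entry := entry) ⟨w + 1, hw⟩ inp rev diag diag' [] (row.reverse ++ [])
      (.inl none :: out)
    have h (row out) : RunsIn (machine entry).step 1
        (some (.back ⟨w + 1, hw⟩), stk inp rev diag diag' row [] out)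
        (some (.forth ⟨w, hw'⟩), stk inp rev diag diag' row [] out) :=
      runsIn_head rfl (by rintro ⟨⟩ <;> rfl) (.refl _ _)
    have h₃ := (h₁.trans h₂).trans (h _ _)
    simp only [List.append_nil, List.reverse_reverse, List.length_reverse] at h₃
    have h₄ := h₃.trans (ih hw' _)
    rw [List.ofFn_succ']
    simp only [encodeRows, List.map_append, List.flatten_append, List.concat_eq_append,
      List.append_assoc] at h₄ ⊢
    refine RunsIn.mono ?_ (Nat.le_of_eq ?_)
      (m := row.length + 1 + row.length + 1 + (w + 1) * (2 * (row.length + 1)))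
    · have hc : Fin.castLE hw (Fin.last (w + 1)) = ⟨w + 1, hw⟩ := rfl
      simpa [encodeRow, hc] using h₄
    · rw [Nat.add_mul (w + 1) 1]; omega

theorem run_write_row (r : List (Bool × Bool)) (inp rev diag diag' out)
    (hrev : rev = [] ∨ ∃ rev', rev = .inl none :: rev') :
    RunsIn (machine entry).step ((2 * m + 5) * (encodeRow r).length)
      (some .write, stk inp ((encodeRow r).reverse ++ rev) diag diag' [] [] out)
      (some .write, stk inp rev diag diag' [] [] (encodeRows (expandRow entry r) ++ out)) := by
  have h₁ := run_load (entry := entry) r.reverse inp rev diag diag' [] [] out hrev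
  have h₂ := run_copies (entry := entry) m (Nat.lt_succ_self m) inp rev diag diag'
    (r.reverse.reverse ++ []) out
  have h₃ := run_clear (entry := entry) inp rev diag diag' (r.reverse.reverse ++ []) []
    (encodeRows (expandRow entry (r.reverse.reverse ++ [])) ++ out)
  have h₄ := (h₁.trans h₂).trans h₃
  simp only [List.reverse_reverse, List.append_nil] at h₄
  simp only [encodeRow, List.reverse_append, List.append_assoc]
  refine (runsIn_head rfl (by rintro ⟨⟩ <;> rfl) (List.map_reverse ▸ h₄)).mono ?_
  simp
  ring_nf
  omega

theorem encodeRows_reverse {X : Type} (rs : List (List X)) :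
    (encodeRows rs).reverse = [] ∨ ∃ l, (encodeRows rs).reverse = .inl none :: l := by
  rcases List.eq_nil_or_concat rs with rfl | ⟨rs, r, rfl⟩
  · exact Or.inl rfl
  · exact Or.inr ⟨_, by simp [encodeRows, encodeRow]; rfl⟩

/-- The induction is from the end of the list because the last row is on top of the stack. -/
theorem run_write_rows (rs : List (List (Bool × Bool))) (inp diag diag' out) :
    ∃ S, RunsIn (machine entry).step ((2 * m + 5) * (encodeRows rs).length + 1)
      (some .write, stk inp (encodeRows rs).reverse diag diag' [] [] out) (none, S) ∧
      S .out = encodeRows (rs.flatMap (expandRow entry)) ++ out := by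
  induction rs using List.reverseRecOn generalizing out with
  | nil => exact ⟨_, runsIn_head rfl (fun _ => rfl) (.refl _ _), rfl⟩
  | append_singleton rs r ih =>
    obtain ⟨S, h, hS⟩ := ih (encodeRows (expandRow entry r) ++ out)
    have h₁ := run_write_row (entry := entry) r inp _ diag diag' out (encodeRows_reverse rs)
    refine ⟨S, ?_, ?_⟩
    · have h₂ := h₁.trans h
      simp only [encodeRows, List.map_append, List.flatten_append, List.map_cons, List.map_nil,
        List.flatten_cons, List.flatten_nil, List.append_nil, List.reverse_append] at h₂ ⊢
      refine h₂.mono (Nat.le_of_eq ?_)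
      rw [List.length_append]
      ring
    · rw [hS, ← List.append_assoc]
      congr 1
      simp [encodeRows]

theorem length_encodeRows_annotateRows (ds : List Bool) (rs : List (List Bool)) :
    (encodeRows (annotateRows ds rs)).length = (encodeRows rs).length := by
  induction rs generalizing ds with
  | nil => rfl
  | cons r rs ih =>
    have := ih (false :: ds)
    simp only [encodeRows, annotateRows, List.map_cons, List.flatten_cons, List.length_append,
      length_encodeRow, length_annotate] at this ⊢
    omega

/-- The output and the running time of the machine. -/
theorem run_machine (rs : List (List Bool)) (t : List Bool)
    (hrs : ∀ r ∈ rs, r.length = rs.length) :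
    ∃ S, RunsIn (machine entry).step ((2 * m + 8) * ((encodeRows rs).length + t.length) + 3)
      (some .start, Function.update (fun _ => []) .inp (encodeRows rs ++ t.map .inr)) (none, S) ∧
      S .out = encodeRows ((annotateRows [true] rs).flatMap (expandRow entry)) ++ t.map .inr := by
  obtain ⟨diag', h₁⟩ := run_read_rows (entry := entry) rs rs.length (t.map .inr) [] [true] [] [] []
    hrs (by simp; omega)
  have h₂ := run_read_suffix (entry := entry) t
    ((encodeRows (annotateRows [true] rs)).reverse ++ []) diag' [] [] [] []
  have h₃ := run_write_suffix (entry := entry) t.reverse []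
    ((encodeRows (annotateRows [true] rs)).reverse ++ []) diag' [] [] [] []
  obtain ⟨S, h₄, hS⟩ := run_write_rows (entry := entry) (annotateRows [true] rs) [] diag' []
    (t.reverse.reverse.map .inr ++ [])
  rw [List.append_nil] at h₁ h₂ h₃
  refine ⟨S, ?_, ?_⟩
  · refine (runsIn_head rfl ?_ (h₁.trans (h₂.trans (h₃.trans h₄)))).mono ?_
    · rintro ⟨⟩ <;> rfl
    · rw [length_encodeRows_annotateRows]
      simp
      ring_nf
      omega
  · rw [hS, List.append_nil, List.reverse_reverse]
    rfl

end AttachMachine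

/-! ### The output is the adjacency matrix of C(G, F) -/

namespace AttachMachine

theorem annotate_ofFn {n : ℕ} (f : Fin n → Bool) (ds : List Bool) :
    annotate (List.ofFn f) ds = List.ofFn fun j => (f j, ds.getD j false) := by
  induction n generalizing ds with
  | zero => simp [annotate]
  | succ n ih => cases ds <;> simp [annotate, List.ofFn_succ, ih]

theorem annotateRows_ofFn {n : ℕ} (f : Fin n → List Bool) (ds : List Bool) :
    annotateRows ds (List.ofFn f) =
      List.ofFn fun i => annotate (f i) (List.replicate i false ++ ds) := by
  induction n generalizing ds with
  | zero => simp [annotateRows]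
  | succ n ih =>
    simp [annotateRows, List.ofFn_succ, ih, List.replicate_succ']

/-- The list is the content of `diag` during row i, so the flags mark exactly the diagonal. -/
theorem getD_replicate_append (i j : ℕ) :
    (List.replicate i false ++ [true]).getD j false = decide (i = j) := by
  induction i generalizing j with
  | zero => cases j <;> simp
  | succ i ih => cases j <;> simp [List.replicate_succ]; simpa using ih _

end AttachMachine

open Classical in
theorem encodeGraph_eq (G : Σ n : ℕ, SimpleGraph (Fin n)) :
    (encodeGraph G).map (Sum.inl : _ → Option Bool ⊕ Bool) =
      AttachMachine.encodeRows (List.ofFn fun i => List.ofFn fun j => decide (G.2.Adj i j)) := by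
  simp only [encodeGraph, AttachMachine.encodeRows, List.map_flatten, List.map_ofFn]
  congr 2
  funext i
  simp [AttachMachine.encodeRow, List.map_ofFn, Function.comp_def]

/-- The graph `C(G, F)` with vertices `0, …, n * k - 1`. -/
def attachFin {m : ℕ} (F : SimpleGraph (Fin (m + 1))) (u : Fin (m + 1))
    (G : Σ n : ℕ, SimpleGraph (Fin n)) : Σ n : ℕ, SimpleGraph (Fin n) :=
  ⟨G.1 * (m + 1), (G.2.attachCopies F u).comap finProdFinEquiv.symm⟩

open Classical in
/-- The entries of the rows of `C(G, F)` that arise from an entry of the row of `v` in `G`, in the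
row of `(v, w)`. -/
def attachEntry {m : ℕ} (F : SimpleGraph (Fin (m + 1))) (u : Fin (m + 1)) (w : Fin (m + 1))
    (x : Bool × Bool) : List Bool :=
  List.ofFn fun w' => (x.2 && decide (F.Adj w w')) || (decide (w = u) && decide (w' = u) && x.1)

-- With (v, w) numbered v(m + 1) + w, a row of G turns into m + 1 consecutive rows and an entry into
-- m + 1 consecutive entries. The flags are needed because the edges of F appear only for equal
-- first coordinates, and a zero in the matrix of G does not tell whether it is on the diagonal.
open Classical AttachMachine in
theorem encodeGraph_attachFin {m : ℕ} (F : SimpleGraph (Fin (m + 1))) (u : Fin (m + 1))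
    (G : Σ n : ℕ, SimpleGraph (Fin n)) :
    (encodeGraph (attachFin F u G)).map (Sum.inl : _ → Option Bool ⊕ Bool) =
      encodeRows ((annotateRows [true] (List.ofFn fun i => List.ofFn fun j =>
        decide (G.2.Adj i j))).flatMap (expandRow (attachEntry F u))) := by
  rw [encodeGraph_eq]
  congr 1
  obtain ⟨n, G⟩ := G
  simp only [annotateRows_ofFn, annotate_ofFn, getD_replicate_append, attachFin]
  rw [List.ofFn_mul, List.flatMap_def, List.map_ofFn]
  congr 2
  funext i
  simp only [Function.comp_apply, expandRow]
  congr 1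
  funext w
  rw [List.ofFn_mul, List.flatMap_def, List.map_ofFn]
  congr 2
  funext j
  simp only [Function.comp_apply, attachEntry]
  congr 1
  funext w'
  have h (a : Fin n) (b : Fin (m + 1)) (h) :
      finProdFinEquiv.symm (⟨a * (m + 1) + b, h⟩ : Fin (n * (m + 1))) = (a, b) := by
    rw [Equiv.symm_apply_eq]
    ext
    simp [finProdFinEquiv]
    ring
  simp [h, SimpleGraph.attachCopies, Fin.ext_iff, Bool.and_assoc]

theorem FiniteGraph.exists_iso_fin (F : FiniteGraph) :
    ∃ (m : ℕ) (F' : SimpleGraph (Fin (m + 1))), Nonempty (F.graph ≃g F') := by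
  have := F.finite_V
  have := F.nonempty_V
  obtain ⟨m, hm⟩ := Nat.exists_eq_succ_of_ne_zero (Nat.card_pos (α := F.V)).ne'
  let e : Fin (m + 1) ≃ F.V := (Finite.equivFinOfCardEq hm).symm
  exact ⟨m, F.graph.comap e, ⟨(SimpleGraph.Iso.comap e F.graph).symm⟩⟩

/-- The graph `attachFin F' u' G` is `C(G, F)`, for a graph `F'` isomorphic to `F`. -/
def attachFinIso {V W : Type*} {m : ℕ} {F : SimpleGraph W} {F' : SimpleGraph (Fin (m + 1))}
    (ψ : F ≃g F') (u : W) (G : Σ n : ℕ, SimpleGraph (Fin n)) {H : SimpleGraph V}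
    (φ : G.2 ≃g H) : (attachFin F' (ψ u) G).2 ≃g H.attachCopies F u :=
  (SimpleGraph.Iso.comap finProdFinEquiv.symm _).trans
    (SimpleGraph.attachCopiesIso φ.symm ψ u).symm

/-- The problems for `𝒢` reduce to those for `{C(G, F) : G ∈ 𝒢}`. -/
theorem dominatingSetProblem_reducesTo (F : FiniteGraph) (hF : F.graph.Connected) (u : F.V)
    (𝒢 : Set FiniteGraph) : (dominatingSetProblem 𝒢).ReducesTo
      (isolatingSetProblem F {H | ∃ G ∈ 𝒢, H = F.attachCopies u G}) := by
  classical
  obtain ⟨m, F', ⟨ψ⟩⟩ := F.exists_iso_fin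
  have := F.finite_V
  refine ⟨fun x => (⟨attachFin F' (ψ u) x.1.1, ?_⟩, x.2), ?_, fun x => ?_⟩
  · obtain ⟨H, hH, ⟨φ⟩⟩ := x.1.2
    exact ⟨F.attachCopies u H, ⟨H, hH, rfl⟩, ⟨attachFinIso ψ u x.1.1 φ⟩⟩
  · refine (AttachMachine.machine (attachEntry F' (ψ u))).nonempty_computableInPolyTime
      (Equiv.refl (Option Bool ⊕ Bool)) (Equiv.refl (Option Bool ⊕ Bool))
      (.C (2 * m + 8) * .X + .C 3) fun x => ?_
    obtain ⟨S, h, hS⟩ := AttachMachine.run_machine (entry := attachEntry F' (ψ u))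
      (List.ofFn fun i => List.ofFn fun j => decide (x.1.1.2.Adj i j)) (encodeInt x.2)
      (by simp [List.mem_ofFn])
    rw [← encodeGraph_eq] at h
    rw [← encodeGraph_attachFin] at hS
    refine ⟨S, ?_, hS.trans (List.map_id _).symm⟩
    have hi : ((dominatingSetProblem 𝒢).encoding.encode x).map
        (Equiv.refl (Option Bool ⊕ Bool)).symm =
        (encodeGraph x.1.1).map .inl ++ (encodeInt x.2).map .inr := List.map_id _
    have hl : ((dominatingSetProblem 𝒢).encoding.encode x).length =
        ((encodeGraph x.1.1).map (Sum.inl : _ → Option Bool ⊕ Bool)).length +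
          (encodeInt x.2).length := by
      rw [← List.length_map (Sum.inr : _ → Option Bool ⊕ Bool), ← List.length_append, ← hi]
      exact (List.length_map _).symm
    erw [hi]
    rw [hl]
    exact h.mono (by simp)
  · have key := SimpleGraph.isolationNum_eq_dominationNum hF
      (attachFinIso ψ u x.1.1 SimpleGraph.Iso.refl)
    change (_ : ℤ) ≤ _ ↔ (_ : ℤ) ≤ _
    rw [← key]

/-! ### Transitivity of reductions -/

namespace DecisionProblem

theorem ReducesTo.trans {P Q R : DecisionProblem} (h₁ : P.ReducesTo Q) (h₂ : Q.ReducesTo R) :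
    P.ReducesTo R := by
  obtain ⟨f, ⟨hf⟩, hfy⟩ := h₁
  obtain ⟨g, ⟨hg⟩, hgy⟩ := h₂
  exact ⟨g ∘ f, hf.nonempty_comp hg, fun a => (hfy a).trans (hgy _)⟩

theorem NPHard.of_reducesTo {P Q : DecisionProblem} (hP : P.NPHard) (h : P.ReducesTo Q) :
    Q.NPHard :=
  fun L hL => (hP L hL).trans h

end DecisionProblem

/-! ### A machine that verifies labellings -/

/-- A finite automaton that reads a row of an adjacency matrix together with the symbols attached
to the columns, started with the symbol attached to the row. Some of the symbols are marked. -/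
structure RowAutomaton (p : ℕ) where
  State : Type
  [fintypeState : Fintype State]
  marked : Fin (p + 1) → Bool
  init : Fin (p + 1) → State
  next : State → Bool → Fin (p + 1) → State
  accept : State → Bool

namespace RowAutomaton

attribute [instance] RowAutomaton.fintypeState

open Turing.StackMachine

variable {p : ℕ} (A : RowAutomaton p)

/-- Run the automaton on a row; this fails if there are too few symbols. -/
def runRow : A.State → List Bool → List (Fin (p + 1)) → Option A.State
  | q, [], _ => some q
  | _, _ :: _, [] => none
  | q, b :: r, c :: cs => runRow (A.next q b c) r cs

/-- Subtract `1` from a number in binary, with the least significant digit first; this fails for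
`0`. -/
def decrement : List Bool → Option (List Bool)
  | [] => none
  | true :: t => some (false :: t)
  | false :: t => (decrement t).map (true :: ·)

/-- All rows are accepted, and the number of rows with a marked symbol is bounded. -/
def verifyRows (sym : List (Fin (p + 1))) :
    List (List Bool) → List (Fin (p + 1)) → List Bool → Bool
  | [], _, _ => true
  | _ :: _, [], _ => false
  | r :: rs, c :: own, cnt =>
    match if A.marked c then decrement cnt else some cnt with
    | none => false
    | some cnt' => (A.runRow (A.init c) r sym).any A.accept && verifyRows sym rs own cnt'

/-- Decode a list of numbers in unary. -/
def decodeUnary : Fin (p + 1) → List Bool → List (Fin (p + 1))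
  | _, [] => []
  | c, false :: w => decodeUnary (c + 1) w
  | c, true :: w => c :: decodeUnary 0 w

/-- The stacks: the input, the matrix, two for the binary number, three for the symbols, and the
output. -/
inductive Stack
  | inp | mat | tmp | cnt | sym | own | sym' | out
  deriving DecidableEq

instance : Fintype Stack :=
  ⟨{.inp, .mat, .tmp, .cnt, .sym, .own, .sym', .out}, by rintro ⟨⟩ <;> simp⟩

/-- The stack alphabets. -/
abbrev Γ (p : ℕ) : Stack → Type
  | .inp => (Option Bool ⊕ Bool) ⊕ Bool
  | .mat => Option Bool
  | .tmp => Bool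
  | .cnt => Bool
  | .sym => Fin (p + 1)
  | .own => Fin (p + 1)
  | .sym' => Fin (p + 1)
  | .out => Bool

instance : ∀ k, Fintype (Γ p k)
  | .inp => inferInstanceAs (Fintype ((Option Bool ⊕ Bool) ⊕ Bool))
  | .mat => inferInstanceAs (Fintype (Option Bool))
  | .tmp => inferInstanceAs (Fintype Bool)
  | .cnt => inferInstanceAs (Fintype Bool)
  | .sym => inferInstanceAs (Fintype (Fin (p + 1)))
  | .own => inferInstanceAs (Fintype (Fin (p + 1)))
  | .sym' => inferInstanceAs (Fintype (Fin (p + 1)))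
  | .out => inferInstanceAs (Fintype Bool)

/-- The content of all stacks. -/
def stk (inp : List ((Option Bool ⊕ Bool) ⊕ Bool)) (mat : List (Option Bool))
    (tmp cnt : List Bool) (sym own sym' : List (Fin (p + 1))) (out : List Bool) :
    ∀ k, List (Γ p k)
  | .inp => inp
  | .mat => mat
  | .tmp => tmp
  | .cnt => cnt
  | .sym => sym
  | .own => own
  | .sym' => sym'
  | .out => out

/-- The labels. -/
inductive Label (p : ℕ) (Q : Type)
  | read (c : Fin (p + 1)) | flip | sign | row | own | decr (q : Q) | undo (q : Q)
  | entry (q : Q) | cell (q : Q) (b : Bool) | rest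
  deriving Fintype

/-- The stack that is popped at a label. -/
abbrev source {Q : Type} : Label p Q → Stack
  | .read _ => .inp
  | .flip => .tmp
  | .sign => .cnt
  | .row => .mat
  | .own => .own
  | .decr _ => .cnt
  | .undo _ => .tmp
  | .entry _ => .mat
  | .cell _ _ => .sym
  | .rest => .sym'

/-- The action of the machine. In a first phase, the input is distributed to the stacks. In a second
phase, the rows are treated one by one. -/
def act : ∀ l : Label p A.State, Option (Γ p (source l)) →
    List (Σ k, Γ p k) × Option (Label p A.State)
  | .read _, none => ([], some .flip)
  | .read c, some (.inl (.inl x)) => ([⟨.mat, x⟩], some (.read c))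
  | .read c, some (.inl (.inr b)) => ([⟨.tmp, b⟩], some (.read c))
  | .read c, some (.inr false) => ([], some (.read (c + 1)))
  -- Two copies are kept: `own` gives up one symbol per row, while `sym` is scanned again for every
  -- row.
  | .read c, some (.inr true) => ([⟨.sym, c⟩, ⟨.own, c⟩], some (.read 0))
  | .flip, some b => ([⟨.cnt, b⟩], some .flip)
  | .flip, none => ([], some .sign)
  | .sign, some false => ([], some .row)
  -- A negative threshold is rejected at once.
  | .sign, some true => ([⟨.out, false⟩], none)
  | .sign, none => ([⟨.out, false⟩], none)
  | .row, none => ([⟨.out, true⟩], none)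
  | .row, some none => ([], some .own)
  | .row, some (some _) => ([⟨.out, false⟩], none)
  | .own, none => ([⟨.out, false⟩], none)
  | .own, some c => ([], some (bif A.marked c then .decr (A.init c) else .entry (A.init c)))
  | .decr _, none => ([⟨.out, false⟩], none)
  | .decr q, some true => ([⟨.cnt, false⟩], some (.undo q))
  -- Borrowing: zeros become ones until a digit one is found, and `undo` then puts them back.
  | .decr q, some false => ([⟨.tmp, true⟩], some (.decr q))
  | .undo q, none => ([], some (.entry q))
  | .undo q, some b => ([⟨.cnt, b⟩], some (.undo q))
  | .entry q, none => bif A.accept q then ([], some .rest) else ([⟨.out, false⟩], none)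
  | .entry q, some none =>
    bif A.accept q then ([⟨.mat, none⟩], some .rest) else ([⟨.out, false⟩], none)
  | .entry q, some (some b) => ([], some (.cell q b))
  | .cell _ _, none => ([⟨.out, false⟩], none)
  | .cell q b, some c => ([⟨.sym', c⟩], some (.entry (A.next q b c)))
  | .rest, none => ([], some .row)
  | .rest, some c => ([⟨.sym, c⟩], some .rest)

/-- The machine. -/
def machine : StackMachine where
  K := Stack
  Γ := Γ p
  Λ := Label p A.State
  input := .inp
  output := .out
  main := .read 0
  source := source
  act := A.act

/-- The machine stops within `n` steps with output `b`. -/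
def Halts (n : ℕ) (c : A.machine.Cfg) (b : Bool) : Prop :=
  ∃ S, RunsIn A.machine.step n c (none, S) ∧ S .out = [b]

variable {A}

theorem Halts.of_runsIn {m n : ℕ} {c d : A.machine.Cfg} {b : Bool} (h : A.Halts n d b)
    (h' : RunsIn A.machine.step m c d) : A.Halts (m + n) c b := by
  obtain ⟨S, hS, hb⟩ := h
  exact ⟨S, h'.trans hS, hb⟩

theorem Halts.mono {m n : ℕ} {c : A.machine.Cfg} {b : Bool} (h : A.Halts m c b) (hmn : m ≤ n) :
    A.Halts n c b := by
  obtain ⟨S, hS, hb⟩ := h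
  exact ⟨S, hS.mono hmn, hb⟩

variable (A)

/-- The matrix as it is stored on its stack: every row is preceded by a separator. -/
def matRows (rs : List (List Bool)) : List (Option Bool) :=
  (rs.map fun r => none :: r.map some).flatten

theorem matRows_eq (rs : List (List Bool)) :
    matRows rs = [] ∨ ∃ l, matRows rs = none :: l := by
  cases rs with
  | nil => exact Or.inl rfl
  | cons r rs => exact Or.inr ⟨_, rfl⟩

theorem run_undo (q : A.State) (inp mat tmp cnt sym own sym' out) :
    RunsIn A.machine.step (tmp.length + 1)
      (some (.undo q), stk inp mat tmp cnt sym own sym' out)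
      (some (.entry q), stk inp mat [] (tmp.reverse ++ cnt) sym own sym' out) := by
  induction tmp generalizing cnt with
  | nil => exact runsIn_head rfl (by rintro ⟨⟩ <;> rfl) (.refl _ _)
  | cons b tmp ih =>
    rw [List.reverse_cons, List.append_assoc]
    exact runsIn_head rfl (by rintro ⟨⟩ <;> rfl) (ih (b :: cnt))

theorem run_decr (q : A.State) (inp mat tmp cnt cnt' sym own sym' out)
    (h : decrement cnt = some cnt') :
    RunsIn A.machine.step (2 * cnt.length + tmp.length + 2)
      (some (.decr q), stk inp mat tmp cnt sym own sym' out)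
      (some (.entry q), stk inp mat [] (tmp.reverse ++ cnt') sym own sym' out) := by
  induction cnt generalizing tmp cnt' with
  | nil => cases h
  | cons b cnt ih =>
    cases b with
    | true =>
      cases h
      refine RunsIn.mono (runsIn_head rfl ?_
        (A.run_undo q inp mat tmp (false :: cnt) sym own sym' out)) (by simp)
      rintro ⟨⟩ <;> rfl
    | false =>
      obtain ⟨cnt₃, h', rfl⟩ := Option.map_eq_some_iff.1 h
      have ih := ih (true :: tmp) cnt₃ h'
      rw [List.reverse_cons, List.append_assoc] at ih
      refine RunsIn.mono (runsIn_head rfl ?_ ih) (by simp; omega)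
      rintro ⟨⟩ <;> rfl

theorem halts_decr (q : A.State) (inp mat tmp cnt sym own sym')
    (h : decrement cnt = none) :
    A.Halts (cnt.length + 1) (some (.decr q), stk inp mat tmp cnt sym own sym' []) false := by
  induction cnt generalizing tmp with
  | nil => exact ⟨_, runsIn_head rfl (fun _ => rfl) (.refl _ _), rfl⟩
  | cons b cnt ih =>
    cases b with
    | true => cases h
    | false =>
      obtain ⟨S, hS, hb⟩ := ih (true :: tmp) (Option.map_eq_none_iff.1 h)
      exact ⟨S, runsIn_head rfl (by rintro ⟨⟩ <;> rfl) hS, hb⟩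

theorem run_rest (inp mat tmp cnt sym own sym' out) :
    RunsIn A.machine.step (sym'.length + 1)
      (some .rest, stk inp mat tmp cnt sym own sym' out)
      (some .row, stk inp mat tmp cnt (sym'.reverse ++ sym) own [] out) := by
  induction sym' generalizing sym with
  | nil => exact runsIn_head rfl (by rintro ⟨⟩ <;> rfl) (.refl _ _)
  | cons b sym' ih =>
    rw [List.reverse_cons, List.append_assoc]
    exact runsIn_head rfl (by rintro ⟨⟩ <;> rfl) (ih (b :: sym))

/-- Here `b` is the verdict on the remaining rows, so the conjunction covers both early rejection
and continuation. The list `sym'.reverse ++ sym` is invariant during the scan. -/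
theorem halts_entry (q : A.State) (r : List Bool) (inp mat tmp cnt sym own sym')
    (hmat : mat = [] ∨ ∃ l, mat = none :: l) {n : ℕ} {b : Bool}
    (hrow : A.Halts n (some .row, stk inp mat tmp cnt (sym'.reverse ++ sym) own [] []) b) :
    A.Halts (n + 3 * r.length + sym'.length + 2)
      (some (.entry q), stk inp (r.map some ++ mat) tmp cnt sym own sym' [])
      ((A.runRow q r sym).any A.accept && b) := by
  induction r generalizing q sym sym' with
  | nil =>
    have h := hrow.of_runsIn (A.run_rest inp mat tmp cnt sym own sym' [])
    cases hq : A.accept q with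
    | false =>
      refine ⟨pushAll (Γ := Γ p) [⟨.out, false⟩] (stk inp mat.tail tmp cnt sym own sym' []), ?_, ?_⟩
      · refine RunsIn.mono (m := 0 + 1) ?_ (by omega)
        obtain rfl | ⟨l, rfl⟩ := hmat
        · exact runsIn_head (congrArg (fun b => bif b then _ else _) hq)
            (by rintro ⟨⟩ <;> rfl) (.refl _ _)
        · exact runsIn_head (congrArg (fun b => bif b then _ else _) hq)
            (by rintro ⟨⟩ <;> rfl) (.refl _ _)
      · simp [runRow, hq]
        rfl
    | true =>
      have h' : A.Halts (1 + (sym'.length + 1 + n))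
          (some (.entry q), stk inp mat tmp cnt sym own sym' []) b := by
        refine h.of_runsIn ?_
        obtain rfl | ⟨l, rfl⟩ := hmat
        · exact runsIn_head (congrArg (fun b => bif b then _ else _) hq)
            (by rintro ⟨⟩ <;> rfl) (.refl _ _)
        · exact runsIn_head (congrArg (fun b => bif b then _ else _) hq)
            (by rintro ⟨⟩ <;> rfl) (.refl _ _)
      simpa [runRow, hq] using h'.mono (by omega)
  | cons x r ih =>
    cases sym with
    | nil => exact ⟨_, runsIn_head rfl (fun _ => rfl) <| runsIn_head rfl (fun _ => rfl) (.refl _ _),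
        rfl⟩
    | cons c sym =>
      rw [runRow]
      have ih := ih (A.next q x c) sym (c :: sym') (by simpa using hrow)
      refine (ih.of_runsIn (m := 2) ?_).mono (by simp; omega)
      exact runsIn_head rfl (fun _ => rfl) <| runsIn_head rfl (by rintro ⟨⟩ <;> rfl) (.refl _ _)

/-- High-order zeros are kept, so one time bound serves all rows. -/
theorem length_decrement {cnt cnt' : List Bool} (h : decrement cnt = some cnt') :
    cnt'.length = cnt.length := by
  induction cnt generalizing cnt' with
  | nil => cases h
  | cons b cnt ih =>
    cases b with
    | true => cases h; rfl
    | false =>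
      obtain ⟨cnt₃, h', rfl⟩ := Option.map_eq_some_iff.1 h
      simp [ih h']

/-- Per row: 2 steps to fetch the row and its symbol, at most 2|cnt| + 2 to decrement, and at most
3n + 2 to scan the row and restore `sym`. -/
theorem halts_row (rs : List (List Bool)) (n : ℕ) (hrs : ∀ r ∈ rs, r.length ≤ n)
    (inp cnt sym own) :
    A.Halts (rs.length * (2 * cnt.length + 3 * n + 6) + 1)
      (some .row, stk inp (matRows rs) [] cnt sym own [] [])
      (A.verifyRows sym rs own cnt) := by
  induction rs generalizing cnt own with
  | nil => exact ⟨_, runsIn_head rfl (fun _ => rfl) (.refl _ _), rfl⟩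
  | cons r rs ih =>
    simp only [List.mem_cons, forall_eq_or_imp] at hrs
    have h₁ (own) : RunsIn A.machine.step 1
        (some .row, stk inp (matRows (r :: rs)) [] cnt sym own [] [])
        (some .own, stk inp (r.map some ++ matRows rs) [] cnt sym own [] []) :=
      runsIn_head rfl (by rintro ⟨⟩ <;> rfl) (.refl _ _)
    cases own with
    | nil =>
      have h₂ : A.Halts 1 (some .own, stk inp (r.map some ++ matRows rs) [] cnt sym [] [] [])
          false := ⟨_, runsIn_head rfl (fun _ => rfl) (.refl _ _), rfl⟩
      exact (h₂.of_runsIn (h₁ [])).mono (by simp [Nat.add_mul]; omega)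
    | cons c own =>
      have h₂ : RunsIn A.machine.step 1
          (some .own, stk inp (r.map some ++ matRows rs) [] cnt sym (c :: own) [] [])
          (some (bif A.marked c then .decr (A.init c) else .entry (A.init c)),
            stk inp (r.map some ++ matRows rs) [] cnt sym own [] []) :=
        runsIn_head rfl (by rintro ⟨⟩ <;> rfl) (.refl _ _)
      have h₃ := (h₁ (c :: own)).trans h₂
      have h₄ (cnt' : List Bool) (hcnt : cnt'.length = cnt.length) := A.halts_entry (A.init c) r
        inp (matRows rs) [] cnt' sym own [] (matRows_eq rs) (ih hrs.2 cnt' own)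
      cases hc : A.marked c with
      | false =>
        rw [hc] at h₃
        simp only [verifyRows, hc]
        exact ((h₄ cnt rfl).of_runsIn h₃).mono (by simp [Nat.add_mul]; omega)
      | true =>
        rw [hc] at h₃
        simp only [verifyRows, hc, if_true]
        cases hd : decrement cnt with
        | none =>
          exact ((A.halts_decr (A.init c) inp _ [] cnt sym own [] hd).of_runsIn h₃).mono
            (by simp [Nat.add_mul]; omega)
        | some cnt' =>
          have hlen := length_decrement hd
          have h₅ := A.run_decr (A.init c) inp (r.map some ++ matRows rs) [] cnt cnt' sym own [] []
            hd
          have h₆ := ((h₄ cnt' hlen).of_runsIn h₅).of_runsIn h₃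
          refine h₆.mono ?_
          rw [hlen]
          simp [Nat.add_mul]
          omega

theorem run_read_mat (c : Fin (p + 1)) (x : List (Option Bool))
    (inp mat tmp cnt sym own sym' out) :
    RunsIn A.machine.step x.length
      (some (.read c), stk (x.map (fun y => .inl (.inl y)) ++ inp) mat tmp cnt sym own sym' out)
      (some (.read c), stk inp (x.reverse ++ mat) tmp cnt sym own sym' out) := by
  induction x generalizing mat with
  | nil => exact .refl _ _
  | cons y x ih =>
    rw [List.reverse_cons, List.append_assoc]
    exact runsIn_head rfl (by rintro ⟨⟩ <;> rfl) (ih (y :: mat))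

theorem run_read_int (c : Fin (p + 1)) (x : List Bool) (inp mat tmp cnt sym own sym' out) :
    RunsIn A.machine.step x.length
      (some (.read c), stk (x.map (fun y => .inl (.inr y)) ++ inp) mat tmp cnt sym own sym' out)
      (some (.read c), stk inp mat (x.reverse ++ tmp) cnt sym own sym' out) := by
  induction x generalizing tmp with
  | nil => exact .refl _ _
  | cons y x ih =>
    rw [List.reverse_cons, List.append_assoc]
    exact runsIn_head rfl (by rintro ⟨⟩ <;> rfl) (ih (y :: tmp))

theorem run_read_cert (c : Fin (p + 1)) (w : List Bool) (mat tmp cnt sym own sym' out) :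
    RunsIn A.machine.step (w.length + 1)
      (some (.read c), stk (w.map .inr) mat tmp cnt sym own sym' out)
      (some .flip, stk [] mat tmp cnt ((decodeUnary c w).reverse ++ sym)
        ((decodeUnary c w).reverse ++ own) sym' out) := by
  induction w generalizing c sym own with
  | nil => exact runsIn_head rfl (by rintro ⟨⟩ <;> rfl) (.refl _ _)
  | cons b w ih =>
    cases b with
    | false => exact runsIn_head rfl (by rintro ⟨⟩ <;> rfl) (ih (c + 1) sym own)
    | true =>
      simp only [decodeUnary, List.reverse_cons, List.append_assoc]
      exact runsIn_head rfl (by rintro ⟨⟩ <;> rfl) (ih 0 (c :: sym) (c :: own))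

theorem run_flip (inp mat tmp cnt sym own sym' out) :
    RunsIn A.machine.step (tmp.length + 1)
      (some .flip, stk inp mat tmp cnt sym own sym' out)
      (some .sign, stk inp mat [] (tmp.reverse ++ cnt) sym own sym' out) := by
  induction tmp generalizing cnt with
  | nil => exact runsIn_head rfl (by rintro ⟨⟩ <;> rfl) (.refl _ _)
  | cons b tmp ih =>
    rw [List.reverse_cons, List.append_assoc]
    exact runsIn_head rfl (by rintro ⟨⟩ <;> rfl) (ih (b :: cnt))

/-- The function computed by the machine, for a matrix, an integer and a certificate. -/
def verify (rs : List (List Bool)) : List Bool → List Bool → Bool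
  | false :: cnt, w =>
    A.verifyRows (decodeUnary 0 w).reverse (rs.reverse.map List.reverse)
      (decodeUnary 0 w).reverse cnt
  | _, _ => false

theorem reverse_flatten_rows (rs : List (List Bool)) :
    (rs.map fun r => r.map some ++ [none]).flatten.reverse =
      matRows (rs.reverse.map List.reverse) := by
  simp [matRows, List.reverse_flatten, Function.comp_def]

/-- The output and the running time of the machine. -/
theorem halts_machine (rs : List (List Bool)) (n : ℕ) (hrs : ∀ r ∈ rs, r.length ≤ n)
    (t w : List Bool) (x : List (Option Bool))
    (hx : x = (rs.map fun r => r.map some ++ [none]).flatten) :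
    A.Halts (x.length + 2 * t.length + w.length + rs.length * (2 * t.length + 3 * n + 6) + 4)
      (some (.read 0), stk (x.map (fun y => .inl (.inl y)) ++
        (t.map (fun y => .inl (.inr y)) ++ w.map .inr)) [] [] [] [] [] [] [])
      (A.verify rs t w) := by
  have h₁ := A.run_read_mat 0 x (t.map (fun y => .inl (.inr y)) ++ w.map .inr) [] [] [] [] [] [] []
  have h₂ := A.run_read_int 0 t (w.map .inr) (x.reverse ++ []) [] [] [] [] [] []
  have h₃ := A.run_read_cert 0 w (x.reverse ++ []) (t.reverse ++ []) [] [] [] [] []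
  have h₄ := A.run_flip [] (x.reverse ++ []) (t.reverse ++ []) []
    ((decodeUnary 0 w).reverse ++ []) ((decodeUnary 0 w).reverse ++ []) [] []
  have h₅ := h₁.trans (h₂.trans (h₃.trans h₄))
  have hmat : x.reverse = matRows (rs.reverse.map List.reverse) := by
    rw [hx, reverse_flatten_rows]
  simp only [List.append_nil, List.reverse_reverse, hmat, List.length_reverse] at h₅
  suffices h : A.Halts (rs.length * (2 * t.length + 3 * n + 6) + 2)
      (some .sign, stk [] (matRows (rs.reverse.map List.reverse)) [] t
        (decodeUnary 0 w).reverse (decodeUnary 0 w).reverse [] []) (A.verify rs t w) from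
    (h.of_runsIn h₅).mono (by omega)
  match t with
  | [] => exact ⟨_, runsIn_head rfl (fun _ => rfl) (.refl _ _), rfl⟩
  | true :: _ => exact ⟨_, runsIn_head rfl (fun _ => rfl) (.refl _ _), rfl⟩
  | false :: cnt =>
    have h := A.halts_row (rs.reverse.map List.reverse) n
      (by
        intro r hr
        obtain ⟨r', hr', rfl⟩ := List.mem_map.1 hr
        rw [List.length_reverse]
        exact hrs r' (List.mem_reverse.1 hr')) [] cnt (decodeUnary 0 w).reverse
      (decodeUnary 0 w).reverse
    refine (h.of_runsIn (m := 1) (runsIn_head rfl ?_ (.refl _ _))).mono ?_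
    · rintro ⟨⟩ <;> rfl
    · rw [List.length_map, List.length_reverse, Nat.add_comm, Nat.add_assoc]
      refine Nat.add_le_add_right (Nat.mul_le_mul_left _ ?_) _
      simp

end RowAutomaton

/-! ### Which certificates the verifying machine accepts -/

/-- The value of a list of binary digits, with the least significant digit first. -/
def binaryValue : List Bool → ℕ
  | [] => 0
  | b :: t => b.toNat + 2 * binaryValue t

theorem binaryValue_encodeNat (n : ℕ) : binaryValue (encodeNat n) = n := by
  have h (m : PosNum) : binaryValue (encodePosNum m) = m := by
    induction m with
    | one => rfl
    | bit0 m ih => simp [encodePosNum, binaryValue, ih]; omega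
    | bit1 m ih => simp [encodePosNum, binaryValue, ih]; omega
  have h' (m : Num) : binaryValue (encodeNum m) = m := by
    cases m with
    | zero => rfl
    | pos m => exact (h m).trans (Num.cast_pos m).symm
  rw [encodeNat, h']
  exact Num.to_of_nat n

namespace RowAutomaton

variable {p : ℕ} (A : RowAutomaton p)

theorem decrement_eq_none {cnt : List Bool} (h : decrement cnt = none) : binaryValue cnt = 0 := by
  induction cnt with
  | nil => rfl
  | cons b cnt ih =>
    cases b with
    | true => cases h
    | false => simp [binaryValue, ih (Option.map_eq_none_iff.1 h)]

theorem decrement_eq_some {cnt cnt' : List Bool} (h : decrement cnt = some cnt') :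
    binaryValue cnt = binaryValue cnt' + 1 := by
  induction cnt generalizing cnt' with
  | nil => cases h
  | cons b cnt ih =>
    cases b with
    | true => cases h; simp [binaryValue]; omega
    | false =>
      obtain ⟨cnt₃, h', rfl⟩ := Option.map_eq_some_iff.1 h
      simp [binaryValue, ih h']
      omega

/-- Each marked row costs one decrement, which fails only at value zero; surplus symbols are never
looked at. -/
theorem verifyRows_iff {sym : List (Fin (p + 1))} {rs : List (List Bool)}
    {own : List (Fin (p + 1))} {cnt : List Bool} :
    A.verifyRows sym rs own cnt = true ↔ rs.length ≤ own.length ∧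
      (∀ x ∈ rs.zip own, (A.runRow (A.init x.2) x.1 sym).any A.accept = true) ∧
      (own.take rs.length).countP A.marked ≤ binaryValue cnt := by
  induction rs generalizing own cnt with
  | nil => simp [verifyRows]
  | cons r rs ih =>
    cases own with
    | nil => simp [verifyRows]
    | cons c own =>
      simp only [verifyRows, List.length_cons, List.zip_cons_cons, List.mem_cons,
        forall_eq_or_imp, List.take_succ_cons, List.countP_cons, Nat.add_le_add_iff_right]
      cases hc : A.marked c with
      | false => simp [ih]; tauto
      | true =>
        cases hd : decrement cnt with
        | none => simp [decrement_eq_none hd]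
        | some cnt' => simp [ih, decrement_eq_some hd]; tauto

theorem runRow_ofFn_append {n : ℕ} (q : A.State) (r : Fin n → Bool) (s : Fin n → Fin (p + 1))
    (cs : List (Fin (p + 1))) :
    A.runRow q (List.ofFn r) (List.ofFn s ++ cs) =
      some ((List.ofFn fun j => (r j, s j)).foldl (fun q x => A.next q x.1 x.2) q) := by
  induction n generalizing q with
  | zero => simp [runRow]
  | succ n ih => simp [List.ofFn_succ, runRow, ih]

theorem zip_ofFn_append {X Y : Type*} {n : ℕ} (r : Fin n → X) (s : Fin n → Y) (cs : List Y) :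
    (List.ofFn r).zip (List.ofFn s ++ cs) = List.ofFn fun j => (r j, s j) := by
  induction n with
  | zero => simp
  | succ n ih => simp [List.ofFn_succ, ih]

theorem countP_ofFn {X : Type*} {n : ℕ} (s : Fin n → X) (P : X → Bool) :
    (List.ofFn s).countP P = (Finset.univ.filter fun j => P (s j) = true).card := by
  induction n with
  | zero => simp
  | succ n ih =>
    rw [List.ofFn_succ, List.countP_cons, ih, Fin.card_filter_univ_succ']
    simp [Nat.add_comm]

theorem verifyRows_ofFn_iff {n : ℕ} (a : Fin n → Fin n → Bool) (sym : List (Fin (p + 1)))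
    (cnt : List Bool) :
    A.verifyRows sym (List.ofFn fun i => List.ofFn (a i)) sym cnt = true ↔
      ∃ (s : Fin n → Fin (p + 1)) (cs : List (Fin (p + 1))), sym = List.ofFn s ++ cs ∧
        (∀ i, A.accept ((List.ofFn fun j => (a i j, s j)).foldl
          (fun q x => A.next q x.1 x.2) (A.init (s i))) = true) ∧
        (Finset.univ.filter fun j => A.marked (s j) = true).card ≤ binaryValue cnt := by
  rw [verifyRows_iff, List.length_ofFn]
  have key (s : Fin n → Fin (p + 1)) (cs : List (Fin (p + 1))) (h : sym = List.ofFn s ++ cs) :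
      ((∀ x ∈ (List.ofFn fun i => List.ofFn (a i)).zip sym,
        (A.runRow (A.init x.2) x.1 sym).any A.accept = true) ∧
        (sym.take n).countP A.marked ≤ binaryValue cnt) ↔
      (∀ i, A.accept ((List.ofFn fun j => (a i j, s j)).foldl
          (fun q x => A.next q x.1 x.2) (A.init (s i))) = true) ∧
        (Finset.univ.filter fun j => A.marked (s j) = true).card ≤ binaryValue cnt := by
    rw [h, zip_ofFn_append, List.forall_mem_ofFn_iff, ← countP_ofFn s,
      List.take_append_of_le_length (by simp), List.take_of_length_le (by simp)]
    simp [runRow_ofFn_append]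
  constructor
  · rintro ⟨hlen, h⟩
    have hs : sym = List.ofFn (fun j : Fin n => sym[j]) ++ sym.drop n := by
      conv_lhs => rw [← List.take_append_drop n sym]
      congr 1
      apply List.ext_getElem <;> simp [hlen]
    exact ⟨_, _, hs, (key _ _ hs).1 h⟩
  · rintro ⟨s, cs, hs, h⟩
    exact ⟨by simp [hs], (key s cs hs).2 h⟩

/-- Encode a list of numbers in unary. -/
def encodeUnary (cs : List (Fin (p + 1))) : List Bool :=
  cs.flatMap fun c : Fin (p + 1) => List.replicate c.val false ++ [true]

theorem decodeUnary_encodeUnary (cs : List (Fin (p + 1))) :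
    decodeUnary 0 (encodeUnary cs) = cs := by
  have h (c : Fin (p + 1)) (k : ℕ) (w : List Bool) :
      decodeUnary c (List.replicate k false ++ true :: w) =
        (c + Fin.ofNat (p + 1) k) :: decodeUnary 0 w := by
    induction k generalizing c with
    | zero => simp [decodeUnary]
    | succ k ih =>
      rw [List.replicate_succ, List.cons_append, decodeUnary, ih]
      congr 1
      ext
      simp only [Fin.val_add, Fin.val_one', Fin.val_ofNat, Nat.mod_add_mod, Nat.add_mod_mod,
        Nat.add_assoc]
      congr 1
      omega
  induction cs with
  | nil => rfl
  | cons c cs ih =>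
    have hc : encodeUnary (c :: cs) = List.replicate c.val false ++ true :: encodeUnary cs := by
      simp [encodeUnary]
    rw [hc, h, ih]
    congr 1
    ext
    simp

theorem length_encodeUnary_le (cs : List (Fin (p + 1))) :
    (encodeUnary cs).length ≤ (p + 1) * cs.length := by
  induction cs with
  | nil => simp [encodeUnary]
  | cons c cs ih =>
    have := c.isLt
    simp only [encodeUnary, List.flatMap_cons, List.length_append, List.length_replicate,
      List.length_cons, List.length_nil, Nat.mul_add] at ih ⊢
    omega

theorem reverse_ofFn {X : Type*} {n : ℕ} (f : Fin n → X) :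
    (List.ofFn f).reverse = List.ofFn fun i => f i.rev := by
  apply List.ext_getElem
  · simp
  · intro i h _
    simp only [List.getElem_reverse, List.getElem_ofFn, List.length_ofFn]
    congr 1
    ext
    simp [Fin.val_rev]
    omega

/-- The condition on certificates that the machine verifies. -/
theorem exists_verify_iff {n b : ℕ} (hb : (p + 1) * n ≤ b) (a : Fin n → Fin n → Bool)
    (cnt : List Bool) :
    (∃ w : List Bool, w.length ≤ b ∧
      A.verify (List.ofFn fun i => List.ofFn (a i)) (false :: cnt) w = true) ↔
      ∃ s : Fin n → Fin (p + 1),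
        (∀ i, A.accept ((List.ofFn fun j => (a i.rev j.rev, s j)).foldl
          (fun q x => A.next q x.1 x.2) (A.init (s i))) = true) ∧
        (Finset.univ.filter fun j => A.marked (s j) = true).card ≤ binaryValue cnt := by
  have hrows : (List.ofFn fun i => List.ofFn (a i)).reverse.map List.reverse =
      List.ofFn fun i => List.ofFn fun j => a i.rev j.rev := by
    simp [reverse_ofFn, List.map_ofFn, Function.comp_def]
  simp only [verify, hrows, verifyRows_ofFn_iff]
  constructor
  · rintro ⟨w, -, s, cs, -, h⟩
    exact ⟨s, h⟩
  · rintro ⟨s, h⟩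
    -- The symbols are reversed because the machine stacks them as it reads them.
    refine ⟨encodeUnary (List.ofFn s).reverse, ?_, s, [], ?_, h⟩
    · exact (length_encodeUnary_le (List.ofFn s).reverse).trans (by simpa using hb)
    · rw [decodeUnary_encodeUnary]
      simp

end RowAutomaton

/-! ### The automaton for isolation labellings -/

namespace SimpleGraph

open Classical in
/-- Check the part of the condition on isolation labellings that involves a vertex `x`, reading the
row of `x` entry by entry. The states consist of the label of `x`, whether a vertex of `D` was found
in the closed neighbourhood of `x`, the labels found in the neighbourhood of `x`, and whether no
error was found. An entry is read together with the information whether the vertex belongs to `D`,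
and with its label. -/
def labellingNext {W : Type} (F : SimpleGraph W) (u : W) (q : W × Bool × Finset W × Bool)
    (x : Bool × Bool × W) : W × Bool × Finset W × Bool :=
  if x.1 then
    (q.1, q.2.1 || x.2.1, if x.2.2 = u then q.2.2.1 else insert x.2.2 q.2.2.1,
      q.2.2.2 && decide (x.2.2 = u ∨ q.1 = u ∨ (x.2.2 ∉ q.2.2.1 ∧ F.Adj q.1 x.2.2)))
  else q

variable {W : Type} (F : SimpleGraph W) (u : W)

theorem fst_foldl_labellingNext (L : List (Bool × Bool × W)) (q : W × Bool × Finset W × Bool) :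
    (L.foldl (F.labellingNext u) q).1 = q.1 := by
  induction L generalizing q with
  | nil => rfl
  | cons x L ih =>
    rw [List.foldl_cons, ih, labellingNext]
    split_ifs <;> rfl

theorem foldl_labellingNext_found (L : List (Bool × Bool × W)) (q : W × Bool × Finset W × Bool) :
    (L.foldl (F.labellingNext u) q).2.1 = true ↔
      q.2.1 = true ∨ ∃ x ∈ L, x.1 = true ∧ x.2.1 = true := by
  induction L generalizing q with
  | nil => simp
  | cons x L ih =>
    rw [List.foldl_cons, ih, labellingNext]
    split_ifs with h <;> simp [h, or_assoc]

/-- The set in the state collects the labels other than u of the neighbours read so far. Hence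
testing each new label against it amounts to pairwise distinctness, together with avoidance of the
initial set. -/
theorem foldl_labellingNext_correct (L : List (Bool × Bool × W))
    (q : W × Bool × Finset W × Bool) :
    (L.foldl (F.labellingNext u) q).2.2.2 = true ↔ q.2.2.2 = true ∧ (q.1 ≠ u →
      (∀ x ∈ L, x.1 = true → x.2.2 ≠ u → x.2.2 ∉ q.2.2.1 ∧ F.Adj q.1 x.2.2) ∧
      L.Pairwise fun x y => x.1 = true → y.1 = true → x.2.2 ≠ u → x.2.2 ≠ y.2.2) := by
  induction L generalizing q with
  | nil => simp
  | cons x L ih =>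
    obtain ⟨w, d, s, o⟩ := q
    obtain ⟨b, d', w'⟩ := x
    rw [List.foldl_cons, ih, labellingNext]
    cases b with
    | false => simp
    | true =>
      by_cases hw' : w' = u
      · simp [hw']
      · by_cases hw : w = u
        · simp [hw]
        · simp only [if_true, hw', if_false, hw, List.mem_cons, List.pairwise_cons]
          simp [hw, hw']
          grind

open Classical in
/-- The automaton that checks isolation labellings. -/
def labellingAutomaton [Finite W] {p : ℕ} (e : Fin (p + 1) ≃ Bool × W) : RowAutomaton p where
  State := W × Bool × Finset W × Bool
  fintypeState := Fintype.ofFinite _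
  marked c := (e c).1
  init c := ((e c).2, (e c).1, ∅, true)
  next q b c := F.labellingNext u q (b, e c)
  accept q := q.2.2.2 && decide (q.1 = u → q.2.1 = true)

open Classical in
theorem labellingAutomaton_accept_iff [Finite W] {p n : ℕ} (e : Fin (p + 1) ≃ Bool × W)
    (G : SimpleGraph (Fin n)) (s : Fin n → Fin (p + 1)) :
    (∀ i, (F.labellingAutomaton u e).accept
      ((List.ofFn fun j => (decide (G.Adj i j), s j)).foldl
        (fun q x => (F.labellingAutomaton u e).next q x.1 x.2)
        ((F.labellingAutomaton u e).init (s i))) = true) ↔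
      G.IsIsolationLabelling F u (Finset.univ.filter fun j => (e (s j)).1 = true)
        fun j => (e (s j)).2 := by
  have hfold (i : Fin n) : (List.ofFn fun j => (decide (G.Adj i j), s j)).foldl
        (fun q x => (F.labellingAutomaton u e).next q x.1 x.2)
        ((F.labellingAutomaton u e).init (s i)) =
      (List.ofFn fun j => (decide (G.Adj i j), e (s j))).foldl (F.labellingNext u)
        ((e (s i)).2, (e (s i)).1, ∅, true) := by
    have : (List.ofFn fun j => (decide (G.Adj i j), e (s j))) =
        (List.ofFn fun j => (decide (G.Adj i j), s j)).map fun x => (x.1, e x.2) := by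
      rw [List.map_ofFn]; rfl
    rw [this, List.foldl_map]
    rfl
  have hacc (q : W × Bool × Finset W × Bool) : (F.labellingAutomaton u e).accept q = true ↔
      q.2.2.2 = true ∧ (q.1 = u → q.2.1 = true) := by
    simp [labellingAutomaton, imp_iff_not_or]
  have hex (i : Fin n) : (∃ x ∈ List.ofFn fun j => (decide (G.Adj i j), e (s j)),
      x.1 = true ∧ x.2.1 = true) ↔ ∃ j, G.Adj i j ∧ (e (s j)).1 = true := by
    constructor
    · rintro ⟨x, hx, h⟩
      obtain ⟨j, rfl⟩ := List.mem_ofFn.1 hx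
      exact ⟨j, by simpa using h⟩
    · rintro ⟨j, h⟩
      exact ⟨_, List.mem_ofFn.2 ⟨j, rfl⟩, by simpa using h⟩
  simp only [hfold]
  refine (forall_congr' fun i => hacc _).trans ?_
  simp only [fst_foldl_labellingNext, foldl_labellingNext_found, foldl_labellingNext_correct,
    List.forall_mem_ofFn_iff, List.pairwise_ofFn, hex]
  rw [forall_and, and_comm]
  refine and_congr (forall_congr' fun i => imp_congr_right fun _ => ?_)
    (forall_congr' fun i => ?_)
  · simp [closedNbhd, G.adj_comm, and_comm]
  · simp only [Finset.notMem_empty, not_false_eq_true, decide_eq_true_eq, true_and]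
    refine imp_congr_right fun _ => ⟨fun ⟨h₁, h₂⟩ j hj hju => ⟨h₁ j hj hju, fun j' hj' hl => ?_⟩,
      fun h => ⟨fun j hj hju => (h j hj hju).1, fun j j' hlt hj hj' hju hl =>
        hlt.ne' ((h j hj hju).2 j' hj' hl.symm)⟩⟩
    -- The automaton compares a label only with those read earlier; the condition is symmetric, as
    -- equal labels are both different from u.
    rcases lt_trichotomy j j' with hlt | rfl | hlt
    · exact absurd hl.symm (h₂ hlt hj hj' hju)
    · rfl
    · exact absurd hl (h₂ hlt hj' hj (hl ▸ hju))

end SimpleGraph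

/-! ### Membership in NP -/

namespace SimpleGraph

open Classical in
/-- The `F`-isolation number of a graph isomorphic to some `C(G, F)` is at most `t` if and only if
the verifier accepts some short certificate. -/
theorem isolationNum_le_iff_exists_verify {V W : Type} [Finite V] [Finite W] {F : SimpleGraph W}
    (hF : F.Connected) {u : W} {G : SimpleGraph V} {n p : ℕ} {H : SimpleGraph (Fin n)}
    (φ : H ≃g G.attachCopies F u) (e : Fin (p + 1) ≃ Bool × W) {b : ℕ} (hb : (p + 1) * n ≤ b)
    (t : ℤ) : (H.isolationNum F : ℤ) ≤ t ↔ ∃ w : List Bool, w.length ≤ b ∧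
      (F.labellingAutomaton u e).verify (List.ofFn fun i => List.ofFn fun j => decide (H.Adj i j))
        (encodeInt t) w = true := by
  rcases lt_or_ge t 0 with ht | ht
  · simp only [encodeInt, ht, decide_true, RowAutomaton.verify, Bool.false_eq_true, and_false,
      exists_false, iff_false]
    omega
  · lift t to ℕ using ht
    -- The machine sees the matrix with rows and columns reversed, that is, an isomorphic graph, and
    -- labellings are transported along the isomorphism.
    have hrev : H.comap Fin.revPerm ≃g H := Iso.comap Fin.revPerm H
    rw [Nat.cast_le, isolationNum_le_iff_exists_labelling hF φ]
    have hle : ¬ (t : ℤ) < 0 := by omega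
    simp only [encodeInt, hle, decide_false, Int.natAbs_natCast]
    rw [RowAutomaton.exists_verify_iff _ hb, binaryValue_encodeNat]
    have key (s : Fin n → Fin (p + 1)) :=
      F.labellingAutomaton_accept_iff u e (H.comap Fin.revPerm) s
    simp only [comap_adj, Fin.revPerm_apply] at key
    simp only [key]
    constructor
    · rintro ⟨D, l, h, hc⟩
      have h' := h.comap hrev
      refine ⟨fun j => e.symm (decide (j ∈ D.map hrev.symm.toEquiv.toEmbedding), (l ∘ hrev) j), ?_⟩
      simp only [Equiv.apply_symm_apply, decide_eq_true_eq, Finset.filter_univ_mem]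
      simp only [labellingAutomaton, Equiv.apply_symm_apply, decide_eq_true_eq,
        Finset.filter_univ_mem, Finset.card_map]
      exact ⟨h', hc⟩
    · rintro ⟨s, h, hc⟩
      exact ⟨_, _, h.comap hrev.symm, by rw [Finset.card_map]; exact hc⟩

end SimpleGraph

/-- The verifier has to be correct only on graphs isomorphic to some C(G,F), where ι ≤ t is
equivalent to the existence of a labelling with at most t vertices in D. -/
theorem isolatingSetProblem_inNP (F : FiniteGraph) (hF : F.graph.Connected) (u : F.V)
    (𝒢 : Set FiniteGraph) :
    (isolatingSetProblem F {H | ∃ G ∈ 𝒢, H = F.attachCopies u G}).InNP := by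
  classical
  have := F.finite_V
  have : Nonempty F.V := F.nonempty_V
  obtain ⟨p, hp⟩ := Nat.exists_eq_succ_of_ne_zero (Nat.card_pos (α := Bool × F.V)).ne'
  -- A certificate symbol tells whether the vertex is in D, and its label.
  let e : Fin (p + 1) ≃ Bool × F.V := (Finite.equivFinOfCardEq hp).symm
  let A := F.graph.labellingAutomaton u e
  have hcount (G : Σ n : ℕ, SimpleGraph (Fin n)) : G.1 ≤ (encodeGraph G).length :=
    (encodeGraph_count G).symm.trans_le List.count_le_length
  have henc (x : GraphIn {H | ∃ G ∈ 𝒢, H = F.attachCopies u G} × ℤ) :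
      (isolatingSetProblem F {H | ∃ G ∈ 𝒢, H = F.attachCopies u G}).encoding.encode x =
        (encodeGraph x.1.1).map .inl ++ (encodeInt x.2).map .inr := rfl
  refine ⟨fun x => A.verify (List.ofFn fun i => List.ofFn fun j => decide (x.1.1.1.2.Adj i j))
    (encodeInt x.1.2) x.2, .C (p + 1) * .X, ?_, fun x => ?_⟩
  · refine A.machine.nonempty_computableInPolyTime
      (Equiv.refl ((Option Bool ⊕ Bool) ⊕ Bool)) (Equiv.refl Bool)
      -- With N the total input length, reading takes at most 2N steps and the rows at most N(3N +
      -- 6), since the matrix encoding is at least as long as the number of vertices.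
      (.C 3 * .X ^ 2 + .C 8 * .X + .C 4) fun x => ?_
    obtain ⟨S, h, hS⟩ := A.halts_machine
      (List.ofFn fun i => List.ofFn fun j => decide (x.1.1.1.2.Adj i j)) x.1.1.1.1
      (by simp [List.mem_ofFn]) (encodeInt x.1.2) x.2 (encodeGraph x.1.1.1)
      (by simp [encodeGraph, List.map_ofFn, Function.comp_def])
    refine ⟨S, ?_, hS.trans (List.map_id _).symm⟩
    have happ (l₁ : List (Option Bool)) (l₂ l₃ : List Bool) :
        (l₁.map Sum.inl ++ l₂.map Sum.inr).map Sum.inl ++ l₃.map Sum.inr =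
          l₁.map (fun y => (Sum.inl (Sum.inl y) : (Option Bool ⊕ Bool) ⊕ Bool)) ++
            (l₂.map (fun y => Sum.inl (Sum.inr y)) ++ l₃.map Sum.inr) := by
      simp [Function.comp_def]
    have hi : (encodingProd (isolatingSetProblem F {H | ∃ G ∈ 𝒢,
        H = F.attachCopies u G}).encoding (encodingList Bool)).encode x =
        (encodeGraph x.1.1.1).map (fun y => Sum.inl (Sum.inl y)) ++
          ((encodeInt x.1.2).map (fun y => Sum.inl (Sum.inr y)) ++ x.2.map Sum.inr) :=
      happ (encodeGraph x.1.1.1) (encodeInt x.1.2) x.2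
    have hlen₃ (l₁ : List (Option Bool)) (l₂ l₃ : List Bool) :
        (l₁.map (fun y => (Sum.inl (Sum.inl y) : (Option Bool ⊕ Bool) ⊕ Bool)) ++
          (l₂.map (fun y => Sum.inl (Sum.inr y)) ++ l₃.map Sum.inr)).length =
          l₁.length + (l₂.length + l₃.length) := by
      simp
    have hlen : ((encodingProd (isolatingSetProblem F {H | ∃ G ∈ 𝒢,
        H = F.attachCopies u G}).encoding (encodingList Bool)).encode x).length =
        (encodeGraph x.1.1.1).length + ((encodeInt x.1.2).length + x.2.length) :=
      (congrArg List.length hi).trans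
        (hlen₃ (encodeGraph x.1.1.1) (encodeInt x.1.2) x.2)
    rw [hlen]
    have hrun (N : ℕ) (l y : List ((Option Bool ⊕ Bool) ⊕ Bool)) (hy : l = y)
        (h : RunsIn A.machine.step N (some (.read 0), RowAutomaton.stk y [] [] [] [] [] [] [])
          (none, S)) : RunsIn A.machine.step N
          (some (.read 0), Function.update (fun _ => []) RowAutomaton.Stack.inp l) (none, S) := by
      subst hy
      convert h using 2
      congr 1
      funext k
      cases k <;> rfl
    refine hrun _ _ _ ((List.map_id _).trans hi) (h.mono ?_)
    have := hcount x.1.1.1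
    simp only [List.length_ofFn, Polynomial.eval_add,
      Polynomial.eval_mul, Polynomial.eval_C, Polynomial.eval_pow, Polynomial.eval_X]
    have hm : x.1.1.1.1 * (2 * (encodeInt x.1.2).length + 3 * x.1.1.1.1 + 6) ≤
        ((encodeGraph x.1.1.1).length + ((encodeInt x.1.2).length + x.2.length)) *
        (3 * ((encodeGraph x.1.1.1).length + ((encodeInt x.1.2).length + x.2.length)) + 6) :=
      Nat.mul_le_mul (by omega) (by omega)
    linarith
  · obtain ⟨_, ⟨G, -, rfl⟩, ⟨φ⟩⟩ := x.1.2
    have := G.finite_V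
    refine SimpleGraph.isolationNum_le_iff_exists_verify hF φ e ?_ x.2
    have hlen₂ (l₁ : List (Option Bool)) (l₂ : List Bool) :
        (l₁.map Sum.inl ++ l₂.map Sum.inr).length = l₁.length + l₂.length := by simp
    have hlen : ((isolatingSetProblem F {H | ∃ G ∈ 𝒢, H = F.attachCopies u G}).encoding.encode
        x).length = (encodeGraph x.1.1).length + (encodeInt x.2).length :=
      (congrArg List.length (henc x)).trans
        (hlen₂ (encodeGraph x.1.1) (encodeInt x.2))
    have := hcount x.1.1
    rw [Polynomial.eval_mul, Polynomial.eval_C, Polynomial.eval_X]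
    exact Nat.mul_le_mul_left _ (by omega)

end

theorem theorem2p4 (F : FiniteGraph) (hF : F.graph.Connected) (u : F.V)
    (𝒢 : Set FiniteGraph) (h𝒢 : (dominatingSetProblem 𝒢).NPComplete) :
    (isolatingSetProblem F {H | ∃ G ∈ 𝒢, H = F.attachCopies u G}).NPComplete :=
  ⟨isolatingSetProblem_inNP F hF u 𝒢,
    h𝒢.2.of_reducesTo (dominatingSetProblem_reducesTo F hF u 𝒢)⟩
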